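/- Let $\Gamma$ be a solvable group generated by a finite set $X$. For $\gamma\in\Gamma\setminus\{1\}$ let $D_\Gamma(\gamma)\in\mathbb N\cup\{\infty\}$ be the least order of a finite quotient of $\Gamma$ in which the image of $\gamma$ is nontrivial (with $D_\Gamma(\gamma)=\infty$ if there is no such quotient), and let $$F_{\Gamma,X}(n)=\max\{D_\Gamma(\gamma) : \gamma\in\Gamma\setminus\{1\},\ \|\gamma\|_X\le n\},$$ where $\|\cdot\|_X$ is the word norm with respect to $X$, and where the maximum of the empty set is $0$. We say that $\Gamma$ has normal residual finiteness growth at most polynomial in $\log(n)$ if there are natural numbers $k\ge 0$ and $M\ge 1$ such that $$F_{\Gamma,X}(n)\le M\,(\log (Mn))^k\quad\text{for all } n\ge 1 .$$ Then $\Gamma$ has normal residual finiteness growth at most polynomial in $\log(n)$ if and only if $\Gamma$ is virtually nilpotent (that is, has a nilpotent subgroup of finite index). -/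

import Mathlib

open scoped ENNReal

/-- The word norm of `g` with respect to `X`: the least length of a word in the letters
`X ∪ X⁻¹` that represents `g` (used only when `X` generates the group). -/
noncomputable def wordNorm {G : Type*} [Group G] (X : Set G) (g : G) : ℕ :=
  sInf {n : ℕ | ∃ l : List G, l.length = n ∧ (∀ x ∈ l, x ∈ X ∨ x⁻¹ ∈ X) ∧ l.prod = g}

/-- The divisibility function `D_G(g)`: the least cardinality of a finite quotient `G ⧸ N` in
which the image of `g` is nontrivial (that is, `g ∉ N`); it is `⊤` if there is no such quotient. -/
noncomputable def normalDivisibility {G : Type*} [Group G] (g : G) : ℕ∞ :=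
  ⨅ (N : Subgroup G) (_ : N.Normal) (_ : Finite (G ⧸ N)) (_ : g ∉ N), (Nat.card (G ⧸ N) : ℕ∞)

/-- The normal residual finiteness growth function `F_{G,X}(n)`: the maximum of `D_G(g)` over the
nontrivial elements `g` of word norm at most `n`. The maximum over the empty set is `0`. -/
noncomputable def normalRFGrowth {G : Type*} [Group G] (X : Set G) (n : ℕ) : ℕ∞ :=
  ⨆ (g : G) (_ : g ≠ 1) (_ : wordNorm X g ≤ n), normalDivisibility g

/-- The relation `f ≼ g`: there is a natural number `M ≥ 1` with `f(n) ≤ M g(M n)` for all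
`n ≥ 1`. In particular `f(n)` is finite for all `n ≥ 1`. -/
def GrowthLE (f : ℕ → ℕ∞) (g : ℕ → ℝ) : Prop :=
  ∃ M : ℕ, 1 ≤ M ∧ ∀ n : ℕ, 1 ≤ n → (f n : ℝ≥0∞) ≤ ENNReal.ofReal (M * g (M * n))

/-- A growth function is at most polynomial in `log n` if `f ≼ (log n)^k` for some `k`. -/
def AtMostPolynomialInLog (f : ℕ → ℕ∞) : Prop :=
  ∃ k : ℕ, GrowthLE f (fun n => Real.log n ^ k)

open scoped ENNReal commutatorElement

universe u

/-! From virtual nilpotency to slow growth. A finitely generated nilpotent group has a central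
series with cyclic factors, and induction along it reduces to elements z^e of a central cyclic
subgroup. Distortion in nilpotent groups is polynomial, so |e| is polynomial in the word length n.
If z has infinite order, some q = O(log n) does not divide a fixed multiple of e
(`exists_not_dvd_le_log`), and then z^e is not a q-th power. In class c the subgroup generated by
all q^c-th powers consists of q-th powers (`exists_pow_eq_of_mem_closure_pow`), so z^e survives in a
quotient of exponent q^c, whose order is at most a fixed power of q. Normal cores carry the bound to
finite extensions.

From slow growth to virtual nilpotency. Suppose that a * b and b satisfy no relation between
positive words of equal length. Then the 2^N words of length N are distinct, and any two are
separated by a quotient of order at most m, where m is polylogarithmic in N. A solvable group of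
order at most m is encoded by a polycyclic presentation with O((log m)^3) exponents, so there are
only exp(polylog m) such quotients (`card_normal_index_le`). Their product is too small to hold 2^N
elements. Hence every pair satisfies a positive relation
(`AtMostPolynomialInLog.positiveRelations`).

The rest is the Milnor-Wolf argument. Positive relations make kernels of maps onto cyclic groups
finitely generated (`PositiveRelations.fg_of_cyclic`). On a finitely generated abelian section they
become linear recurrences with coefficients -1, 0, 1, which force eigenvalues of modulus one; by
Kronecker these are roots of unity, so a power of each element acts unipotently. Therefore virtual
nilpotency passes up cyclic extensions, and induction on the derived length finishes. -/

/-! ### Central series with cyclic factors -/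

/-- `CentralCyclicSeries h G` says that `G` is obtained from the trivial group by `h` successive
central extensions with cyclic kernel. -/
inductive CentralCyclicSeries : ℕ → ∀ (G : Type u) [Group G], Prop
  | base (G : Type u) [Group G] (hG : Subsingleton G) : CentralCyclicSeries 0 G
  | extend (h : ℕ) (G Q : Type u) [Group G] [Group Q] (f : G →* Q)
      (hf : Function.Surjective f) (z : G) (hz : z ∈ Subgroup.center G)
      (hker : f.ker = Subgroup.zpowers z) (hQ : CentralCyclicSeries h Q) :
      CentralCyclicSeries (h + 1) G

theorem Subgroup.fg_of_map_of_inf_ker {G H : Type*} [Group G] [Group H] (f : G →* H)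
    (K : Subgroup G) (h1 : (K.map f).FG) (h2 : (K ⊓ f.ker).FG) : K.FG := by
  classical
  obtain ⟨S, hS⟩ := h1
  obtain ⟨T, hT⟩ := h2
  have hlift : ∀ s ∈ S, ∃ k ∈ K, f k = s := fun s hs => by
    have : s ∈ K.map f := hS ▸ Subgroup.subset_closure hs
    simpa using this
  choose! g hgK hgf using hlift
  refine ⟨S.image g ∪ T, le_antisymm ?_ ?_⟩
  · rw [Subgroup.closure_le]
    intro x hx
    simp only [Finset.coe_union, Finset.coe_image, Set.mem_union, Set.mem_image] at hx
    rcases hx with ⟨s, hs, rfl⟩ | hx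
    · exact hgK s hs
    · have : x ∈ K ⊓ f.ker := hT ▸ Subgroup.subset_closure hx
      exact this.1
  · intro k hk
    set L := Subgroup.closure ((S.image g ∪ T : Finset G) : Set G) with hL
    have hTL : K ⊓ f.ker ≤ L := by
      rw [← hT]
      exact Subgroup.closure_mono (by simp)
    have hLK : L ≤ K := by
      rw [hL, Subgroup.closure_le]
      intro x hx
      simp only [Finset.coe_union, Finset.coe_image, Set.mem_union, Set.mem_image] at hx
      rcases hx with ⟨s, hs, rfl⟩ | hx
      · exact hgK s hs
      · have : x ∈ K ⊓ f.ker := hT ▸ Subgroup.subset_closure hx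
        exact this.1
    have hmap : K.map f ≤ L.map f := by
      rw [← hS, Subgroup.closure_le]
      intro s hs
      refine ⟨g s, Subgroup.subset_closure ?_, hgf s hs⟩
      simp only [Finset.coe_union, Finset.coe_image, Set.mem_union, Set.mem_image]
      exact Or.inl ⟨s, hs, rfl⟩
    obtain ⟨l, hl, hlk⟩ := hmap (Subgroup.mem_map_of_mem f hk)
    have hmem : l⁻¹ * k ∈ L := hTL ⟨K.mul_mem (K.inv_mem (hLK hl)) hk, by
      simp [hlk]⟩
    have := L.mul_mem hl hmem
    simpa using this

theorem Subgroup.fg_of_le_zpowers {G : Type*} [Group G] (z : G) (K : Subgroup G)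
    (hK : K ≤ Subgroup.zpowers z) : K.FG := by
  have : IsCyclic K := by
    have : IsCyclic (K.subgroupOf (Subgroup.zpowers z)) := inferInstance
    exact isCyclic_of_surjective (Subgroup.subgroupOfEquivOfLe hK)
      (Subgroup.subgroupOfEquivOfLe hK).surjective
  obtain ⟨g, hg⟩ := this.exists_generator
  refine (Subgroup.fg_iff _).2 ⟨{(g : G)}, ?_, Set.finite_singleton _⟩
  rw [← Subgroup.zpowers_eq_closure]
  refine le_antisymm ?_ ?_
  · rw [Subgroup.zpowers_le]; exact g.2
  · intro k hk
    obtain ⟨n, hn⟩ := Subgroup.mem_zpowers_iff.1 (hg ⟨k, hk⟩)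
    exact Subgroup.mem_zpowers_iff.2 ⟨n, by simpa using congrArg Subtype.val hn⟩

theorem CentralCyclicSeries.subgroup_fg {h : ℕ} {G : Type u} [Group G]
    (hG : CentralCyclicSeries h G) : ∀ K : Subgroup G, K.FG := by
  induction hG with
  | base G hG =>
    intro K
    rw [Subsingleton.elim K ⊥]
    exact Subgroup.FG.bot
  | extend h G Q f hf z hz hker hQ ih =>
    intro K
    refine Subgroup.fg_of_map_of_inf_ker f K (ih _) ?_
    exact Subgroup.fg_of_le_zpowers z _ (by rw [← hker]; exact inf_le_right)

/-- The generators of the central kernel are divided out one at a time; each spans a normal cyclic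
subgroup because it is central. -/
theorem CentralCyclicSeries.exists_of_ker_le_center {Q : Type u} [Group Q] {h : ℕ}
    (hQ : CentralCyclicSeries h Q) (n : ℕ) :
    ∀ (G : Type u) [Group G] (s : Finset G) (f : G →* Q), s.card ≤ n → Function.Surjective f →
      f.ker = Subgroup.closure (s : Set G) → f.ker ≤ Subgroup.center G →
      ∃ h', CentralCyclicSeries h' G := by
  classical
  induction n with
  | zero =>
    intro G _ s f hs hf hker hcen
    rw [Nat.le_zero, Finset.card_eq_zero] at hs
    subst hs
    -- Here f is an isomorphism. A step with trivial kernel transports the series from Q to G, at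
    -- the cost of one unit of length.
    refine ⟨h + 1, .extend h G Q f hf 1 (Subgroup.one_mem _) ?_ hQ⟩
    rw [hker]; simp
  | succ n ih =>
    intro G _ s f hs hf hker hcen
    rcases s.eq_empty_or_nonempty with rfl | ⟨a, ha⟩
    · exact ih G ∅ f (by simp) hf hker hcen
    obtain ⟨t, hat, rfl⟩ : ∃ t : Finset G, a ∉ t ∧ insert a t = s :=
      ⟨s.erase a, by simp, Finset.insert_erase ha⟩
    rw [Finset.card_insert_of_notMem hat] at hs
    have htn : t.card ≤ n := by omega
    have hacen : a ∈ Subgroup.center G :=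
      hcen (hker ▸ Subgroup.subset_closure (by simp))
    have hN : (Subgroup.zpowers a).Normal := by
      have := (Subgroup.zpowers_le (g := a) (H := Subgroup.center G)).2 hacen
      refine ⟨fun x hx g => ?_⟩
      have hx' := Subgroup.mem_center_iff.1 (this hx) g
      rw [hx']; simpa using hx
    have hle : Subgroup.zpowers a ≤ f.ker := by
      rw [Subgroup.zpowers_le, hker]; exact Subgroup.subset_closure (by simp)
    let g : G ⧸ Subgroup.zpowers a →* Q := QuotientGroup.lift _ f hle
    have hg : Function.Surjective g := fun q => by
      obtain ⟨x, rfl⟩ := hf q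
      exact ⟨(x : G ⧸ Subgroup.zpowers a), rfl⟩
    have hgker : g.ker = f.ker.map (QuotientGroup.mk' (Subgroup.zpowers a)) := by
      ext x
      induction x using QuotientGroup.induction_on with
      | H x =>
        constructor
        · intro hx
          exact ⟨x, hx, rfl⟩
        · rintro ⟨y, hy, hyx⟩
          rw [← hyx]
          exact hy
    have hgcl : g.ker = Subgroup.closure
        ((t.image (QuotientGroup.mk' (Subgroup.zpowers a)) : Finset _) : Set _) := by
      rw [hgker, hker, MonoidHom.map_closure]
      apply le_antisymm
      · rw [Subgroup.closure_le]
        rintro _ ⟨x, hx, rfl⟩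
        rw [Finset.mem_coe, Finset.mem_insert] at hx
        rcases hx with rfl | hx
        · have : QuotientGroup.mk' (Subgroup.zpowers x) x = 1 :=
            (QuotientGroup.eq_one_iff _).2 (Subgroup.mem_zpowers x)
          rw [this]; exact Subgroup.one_mem _
        · exact Subgroup.subset_closure (by
            rw [Finset.coe_image]; exact Set.mem_image_of_mem _ hx)
      · apply Subgroup.closure_mono
        rw [Finset.coe_image]
        exact Set.image_mono (by simp)
    have hgcen : g.ker ≤ Subgroup.center _ := by
      rw [hgker]
      rintro _ ⟨x, hx, rfl⟩
      rw [Subgroup.mem_center_iff]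
      intro y
      induction y using QuotientGroup.induction_on with
      | H y =>
        have := Subgroup.mem_center_iff.1 (hcen hx) y
        exact congrArg (QuotientGroup.mk' (Subgroup.zpowers a)) this
    obtain ⟨h', hh'⟩ := ih _ _ g (Finset.card_image_le.trans htn) hg hgcl hgcen
    exact ⟨h' + 1, .extend h' G _ (QuotientGroup.mk' (Subgroup.zpowers a))
      (QuotientGroup.mk'_surjective _) a hacen (QuotientGroup.ker_mk' _) hh'⟩

theorem commutatorElement_mul_right_of_center {G : Type*} [Group G] (a x y : G)
    (h : ⁅a, y⁆ ∈ Subgroup.center G) : ⁅a, x * y⁆ = ⁅a, x⁆ * ⁅a, y⁆ := by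
  have := Subgroup.mem_center_iff.1 h x
  calc ⁅a, x * y⁆ = a * x * a⁻¹ * ⁅a, y⁆ * x⁻¹ := by
        simp only [commutatorElement_def]; group
    _ = a * x * a⁻¹ * (x⁻¹ * (x * ⁅a, y⁆)) * x⁻¹ := by group
    _ = a * x * a⁻¹ * (x⁻¹ * (⁅a, y⁆ * x)) * x⁻¹ := by rw [this]
    _ = ⁅a, x⁆ * ⁅a, y⁆ := by simp only [commutatorElement_def]; group

theorem commutatorElement_mul_left_of_center {G : Type*} [Group G] (x y a : G)
    (h : ⁅y, a⁆ ∈ Subgroup.center G) : ⁅x * y, a⁆ = ⁅x, a⁆ * ⁅y, a⁆ := by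
  have h' : ⁅a, y⁆ ∈ Subgroup.center G := by
    rw [← commutatorElement_inv]; exact Subgroup.inv_mem _ h
  have := commutatorElement_mul_right_of_center a x y h'
  rw [← commutatorElement_inv, this, mul_inv_rev, commutatorElement_inv, commutatorElement_inv]
  exact (Subgroup.mem_center_iff.1 h _).symm

/-- If `A` is generated by `S` modulo elements commuting with everything, `G` is generated by `T`
and all commutators of `A` with `G` are central, then `⁅A, ⊤⁆` is generated by the commutators of
`S` and `T`. -/
theorem commutator_le_closure_of_central {G : Type*} [Group G] (A : Subgroup G) (S T : Set G)
    (hA : A ≤ Subgroup.closure S ⊔ Subgroup.center G) (hSA : S ⊆ A)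
    (hT : Subgroup.closure T = ⊤) (hcen : ⁅A, (⊤ : Subgroup G)⁆ ≤ Subgroup.center G) :
    ⁅A, (⊤ : Subgroup G)⁆ ≤ Subgroup.closure (Set.image2 (fun s t => ⁅s, t⁆) S T) := by
  set L := Subgroup.closure (Set.image2 (fun s t => ⁅s, t⁆) S T)
  have hc : ∀ a ∈ A, ∀ x, ⁅a, x⁆ ∈ Subgroup.center G := fun a ha x =>
    hcen (Subgroup.commutator_mem_commutator ha (Subgroup.mem_top x))
  have hinvr : ∀ a ∈ A, ∀ x, ⁅a, x⁻¹⁆ = ⁅a, x⁆⁻¹ := fun a ha x => by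
    have := commutatorElement_mul_right_of_center a x x⁻¹ (hc a ha _)
    rw [mul_inv_cancel, commutatorElement_one_right] at this
    exact eq_inv_of_mul_eq_one_right this.symm
  have hinvl : ∀ a ∈ A, ∀ x, ⁅a⁻¹, x⁆ = ⁅a, x⁆⁻¹ := fun a ha x => by
    have := commutatorElement_mul_left_of_center a a⁻¹ x (hc _ (A.inv_mem ha) _)
    rw [mul_inv_cancel, commutatorElement_one_left] at this
    exact eq_inv_of_mul_eq_one_right this.symm
  have h1 : ∀ s ∈ S, ∀ x, ⁅s, x⁆ ∈ L := fun s hs x => by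
    have hx : x ∈ Subgroup.closure T := hT ▸ Subgroup.mem_top x
    induction hx using Subgroup.closure_induction with
    | mem x hx => exact Subgroup.subset_closure ⟨s, hs, x, hx, rfl⟩
    | one => simp
    | mul x y _ _ ihx ihy =>
      rw [commutatorElement_mul_right_of_center _ _ _ (hc s (hSA hs) y)]
      exact L.mul_mem ihx ihy
    | inv x _ ih => rw [hinvr s (hSA hs)]; exact L.inv_mem ih
  have hSA' : Subgroup.closure S ≤ A := (Subgroup.closure_le _).2 hSA
  have h2 : ∀ a ∈ Subgroup.closure S, ∀ x, ⁅a, x⁆ ∈ L := fun a ha x => by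
    induction ha using Subgroup.closure_induction with
    | mem s hs => exact h1 s hs x
    | one => simp
    | mul a b ha hb iha ihb =>
      rw [commutatorElement_mul_left_of_center _ _ _ (hc b (hSA' hb) x)]
      exact L.mul_mem iha ihb
    | inv a ha ih => rw [hinvl a (hSA' ha)]; exact L.inv_mem ih
  rw [Subgroup.commutator_le]
  intro a ha x _
  obtain ⟨s, hs, z, hz, rfl⟩ := Subgroup.mem_sup_of_normal_right.1 (hA ha)
  have hz1 : ⁅z, x⁆ = 1 := by
    rw [commutatorElement_eq_one_iff_mul_comm]
    exact (Subgroup.mem_center_iff.1 hz x).symm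
  rw [commutatorElement_mul_left_of_center _ _ _ (by rw [hz1]; exact Subgroup.one_mem _), hz1,
    mul_one]
  exact h2 s hs x

/-- The last term A of the lower central series is central, and only its finite generation is at
stake. For A = ⁅B, G⁆ the image of B in G ⧸ A is finitely generated by induction, and central
commutators are bilinear, so finitely many of them generate A. -/
theorem CentralCyclicSeries.exists_of_lowerCentralSeries_eq_bot (c : ℕ) :
    ∀ (G : Type u) [Group G] [Group.FG G], (⊤ : Subgroup G).lowerCentralSeries c = ⊥ →
      ∃ h, CentralCyclicSeries h G := by
  induction c with
  | zero =>
    intro G _ _ h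
    exact ⟨0, .base G (Subgroup.subsingleton_iff.1 (subsingleton_of_bot_eq_top h.symm))⟩
  | succ c ih =>
    intro G _ hfg hG
    set A := (⊤ : Subgroup G).lowerCentralSeries c with hA
    have hAcen : A ≤ Subgroup.center G := by
      intro x hx
      rw [Subgroup.mem_center_iff]
      intro y
      have : ⁅x, y⁆ ∈ (⊤ : Subgroup G).lowerCentralSeries (c + 1) :=
        Subgroup.commutator_mem_commutator hx (Subgroup.mem_top y)
      rw [hG, Subgroup.mem_bot, commutatorElement_eq_one_iff_mul_comm] at this
      exact this.symm
    have hquot : (⊤ : Subgroup (G ⧸ A)).lowerCentralSeries c = ⊥ := by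
      have := Subgroup.map_lowerCentralSeries (⊤ : Subgroup G) (QuotientGroup.mk' A) c
      rw [Subgroup.map_top_of_surjective _ (QuotientGroup.mk'_surjective A)] at this
      rw [← this, ← hA, Subgroup.map_eq_bot_iff, QuotientGroup.ker_mk']
    obtain ⟨h, hQ⟩ := ih (G ⧸ A) hquot
    have hAfg : A.FG := by
      obtain ⟨T, hT, hTfin⟩ := Group.fg_iff.1 hfg
      rcases c with _ | c
      · exact Group.fg_def.1 hfg
      · set B := (⊤ : Subgroup G).lowerCentralSeries c with hB
        have hAB : A = ⁅B, (⊤ : Subgroup G)⁆ := rfl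
        obtain ⟨S, hS⟩ := hQ.subgroup_fg (B.map (QuotientGroup.mk' A))
        have hlift : ∀ s ∈ S, ∃ k ∈ B, QuotientGroup.mk' A k = s := fun s hs => by
          have : s ∈ B.map (QuotientGroup.mk' A) := hS ▸ Subgroup.subset_closure hs
          simpa using this
        choose! g hgB hgs using hlift
        have h1 : B ≤ Subgroup.closure (g '' S) ⊔ Subgroup.center G := by
          intro b hb
          have hb' : QuotientGroup.mk' A b ∈ (Subgroup.closure (g '' S)).map
              (QuotientGroup.mk' A) := by
            have : QuotientGroup.mk' A b ∈ Subgroup.closure (S : Set (G ⧸ A)) := by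
              rw [hS]; exact Subgroup.mem_map_of_mem _ hb
            refine (Subgroup.closure_le _).2 ?_ this
            intro s hs
            exact ⟨g s, Subgroup.subset_closure ⟨s, hs, rfl⟩, hgs s hs⟩
          obtain ⟨d, hd, hdb⟩ := hb'
          have : d⁻¹ * b ∈ A := QuotientGroup.eq.1 hdb
          have := Subgroup.mul_mem_sup hd (hAcen this)
          simpa using this
        have h2 : g '' S ⊆ B := by
          rintro _ ⟨s, hs, rfl⟩; exact hgB s hs
        have h3 := commutator_le_closure_of_central B (g '' S) T h1 h2 hT (hAB ▸ hAcen)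
        refine (Subgroup.fg_iff _).2 ⟨_, le_antisymm ?_ h3,
          Set.Finite.image2 _ (S.finite_toSet.image g) hTfin⟩
        rw [Subgroup.closure_le]
        rintro _ ⟨s, hs, t, _, rfl⟩
        exact Subgroup.commutator_mem_commutator (h2 hs) (Subgroup.mem_top t)
    obtain ⟨S, hS⟩ := hAfg
    exact hQ.exists_of_ker_le_center S.card G S (QuotientGroup.mk' A) le_rfl
      (QuotientGroup.mk'_surjective A) (by rw [QuotientGroup.ker_mk', hS])
      (by rw [QuotientGroup.ker_mk']; exact hAcen)

theorem Group.IsNilpotent.exists_centralCyclicSeries (G : Type u) [Group G] [Group.FG G]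
    [hG : Group.IsNilpotent G] : ∃ h, CentralCyclicSeries h G := by
  obtain ⟨c, hc⟩ := Subgroup.nilpotent_iff_lowerCentralSeries.1 hG
  exact CentralCyclicSeries.exists_of_lowerCentralSeries_eq_bot c G hc

/-- If z has finite order, the exponent of the quotient is multiplied by that order. If not, a
torsion element has its K-th power in a torsion-free cyclic group, so the old exponent K still
works. -/
theorem CentralCyclicSeries.exists_torsion_exponent {h : ℕ} {G : Type u} [Group G]
    (hG : CentralCyclicSeries h G) :
    ∃ K : ℕ, 0 < K ∧ ∀ x : G, IsOfFinOrder x → x ^ K = 1 := by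
  induction hG with
  | base G hG => exact ⟨1, one_pos, fun x _ => Subsingleton.elim _ _⟩
  | extend h G Q f hf z hz hker hQ ih =>
    obtain ⟨K, hK, hKx⟩ := ih
    by_cases hzo : IsOfFinOrder z
    · refine ⟨K * orderOf z, Nat.mul_pos hK hzo.orderOf_pos, fun x hx => ?_⟩
      have h1 : x ^ K ∈ f.ker := by
        rw [MonoidHom.mem_ker, map_pow]; exact hKx _ (f.isOfFinOrder hx)
      rw [hker] at h1
      obtain ⟨n, hn⟩ := Subgroup.mem_zpowers_iff.1 h1
      rw [pow_mul, ← hn, ← zpow_natCast, ← zpow_mul, mul_comm, zpow_mul, zpow_natCast,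
        pow_orderOf_eq_one, one_zpow]
    · refine ⟨K, hK, fun x hx => ?_⟩
      have h1 : x ^ K ∈ f.ker := by
        rw [MonoidHom.mem_ker, map_pow]; exact hKx _ (f.isOfFinOrder hx)
      rw [hker] at h1
      obtain ⟨n, hn⟩ := Subgroup.mem_zpowers_iff.1 h1
      have h2 : IsOfFinOrder (z ^ n) := hn ▸ hx.pow
      by_cases hn0 : n = 0
      · rw [← hn, hn0, zpow_zero]
      · obtain ⟨m, hm, hm1⟩ := isOfFinOrder_iff_zpow_eq_one.1 h2
        exact absurd (isOfFinOrder_iff_zpow_eq_one.2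
          ⟨n * m, mul_ne_zero hn0 hm, by rw [zpow_mul, hm1]⟩) hzo

/-- A quotient inherits the series, and a cyclic group of exponent r has order at most r, so each of
the h factors contributes at most r. -/
theorem CentralCyclicSeries.card_le_of_exponent {h : ℕ} {P : Type u} [Group P]
    (hP : CentralCyclicSeries h P) (r : ℕ) (hr : 0 < r) :
    ∀ (Q : Type u) [Group Q] (f : P →* Q), Function.Surjective f → (∀ x : Q, x ^ r = 1) →
      Finite Q ∧ Nat.card Q ≤ r ^ h := by
  induction hP with
  | base G hG =>
    intro Q _ f hf hQ
    have := hf.subsingleton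
    exact ⟨inferInstance, by simp⟩
  | extend h G P' p hp z hz hker hP' ih =>
    intro Q _ f hf hQ
    have hN : (Subgroup.zpowers (f z)).Normal := by
      refine ⟨fun x hx g => ?_⟩
      obtain ⟨n, rfl⟩ := Subgroup.mem_zpowers_iff.1 hx
      obtain ⟨y, rfl⟩ := hf g
      have := Subgroup.mem_center_iff.1 (Subgroup.zpow_mem _ hz n) y
      have h2 : f y * f z ^ n = f z ^ n * f y := by
        rw [← map_zpow, ← map_mul, this, map_mul]
      rw [h2]; simp
    let q := (QuotientGroup.mk' (Subgroup.zpowers (f z))).comp f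
    have hq : Function.Surjective q := (QuotientGroup.mk'_surjective _).comp hf
    have hqk : p.ker ≤ q.ker := by
      rw [hker, Subgroup.zpowers_le, MonoidHom.mem_ker]
      exact (QuotientGroup.eq_one_iff _).2 (Subgroup.mem_zpowers _)
    let g := p.liftOfSurjective hp ⟨q, hqk⟩
    have hgp : ∀ x, g (p x) = q x := fun x =>
      p.liftOfRightInverse_comp_apply _ (Function.rightInverse_surjInv hp) ⟨q, hqk⟩ x
    have hg : Function.Surjective g := fun y => by
      obtain ⟨x, rfl⟩ := hq y
      exact ⟨p x, hgp x⟩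
    obtain ⟨hfin, hcard⟩ := ih _ g hg (fun x => by
      induction x using QuotientGroup.induction_on with
      | H x => rw [← QuotientGroup.mk_pow, hQ]; rfl)
    have hz1 : f z ^ r = 1 := hQ _
    have hzfin : IsOfFinOrder (f z) := isOfFinOrder_iff_pow_eq_one.2 ⟨r, hr, hz1⟩
    have hzc : Nat.card (Subgroup.zpowers (f z)) ≤ r := by
      rw [Nat.card_zpowers]; exact orderOf_le_of_pow_eq_one hr hz1
    have : Finite (Subgroup.zpowers (f z)) :=
      (finite_zpowers.2 hzfin).to_subtype
    have : (Subgroup.zpowers (f z)).FiniteIndex := Subgroup.finiteIndex_of_finite_quotient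
    refine ⟨Subgroup.finite_iff_finite_and_finiteIndex (H := Subgroup.zpowers (f z)) |>.2
      ⟨inferInstance, inferInstance⟩, ?_⟩
    rw [← Subgroup.card_mul_index (Subgroup.zpowers (f z)), Subgroup.index_eq_card, pow_succ,
      mul_comm]
    exact Nat.mul_le_mul hcard hzc

/-! ### Products of powers in nilpotent groups -/

/-- For a in the c-th term, the commutators ⁅a, ·⁆ commute with U, so y ↦ ⁅a, y⁆ is a homomorphism
on U and ⁅a, y ^ q⁆ = ⁅a, y⁆ ^ q. The q-th powers of the commuting elements form a subgroup `B`,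
which therefore contains all the generating commutators. -/
theorem lowerCentralSeries_closure_pow_le {P : Type*} [Group P] (U : Subgroup P) (q c : ℕ)
    (hcen : U.lowerCentralSeries (c + 1) ≤ Subgroup.centralizer (U : Set P)) :
    ∀ x ∈ (Subgroup.closure {x | ∃ y ∈ U, y ^ q = x}).lowerCentralSeries (c + 1),
      ∃ y ∈ U.lowerCentralSeries (c + 1), y ^ q = x := by
  set V := Subgroup.closure {x | ∃ y ∈ U, y ^ q = x} with hV
  have hVU : V ≤ U := by
    rw [hV, Subgroup.closure_le]
    rintro _ ⟨y, hy, rfl⟩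
    exact U.pow_mem hy q
  have hAU : U.lowerCentralSeries c ≤ U := Subgroup.lowerCentralSeries_le_self U c
  have hBU : U.lowerCentralSeries (c + 1) ≤ U := Subgroup.lowerCentralSeries_le_self U (c + 1)
  have hcomm : ∀ x ∈ U.lowerCentralSeries (c + 1), ∀ y ∈ U, Commute x y := fun x hx y hy =>
    (Subgroup.mem_centralizer_iff.1 (hcen hx) y hy).symm
  let B : Subgroup P :=
    { carrier := {x | ∃ y ∈ U.lowerCentralSeries (c + 1), y ^ q = x}
      one_mem' := ⟨1, Subgroup.one_mem _, one_pow q⟩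
      mul_mem' := by
        rintro _ _ ⟨y, hy, rfl⟩ ⟨z, hz, rfl⟩
        exact ⟨y * z, Subgroup.mul_mem _ hy hz, (hcomm y hy z (hBU hz)).mul_pow q⟩
      inv_mem' := by
        rintro _ ⟨y, hy, rfl⟩
        exact ⟨y⁻¹, Subgroup.inv_mem _ hy, inv_pow y q⟩ }
  have hB : B ≤ U.lowerCentralSeries (c + 1) := by
    rintro _ ⟨y, hy, rfl⟩
    exact Subgroup.pow_mem _ hy q
  have hmul : ∀ a ∈ U.lowerCentralSeries c, ∀ x ∈ U, ∀ y ∈ U, ⁅a, x * y⁆ = ⁅a, x⁆ * ⁅a, y⁆ := by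
    intro a ha x hx y hy
    have := hcomm _ (Subgroup.commutator_mem_commutator ha hy) x hx
    calc ⁅a, x * y⁆ = a * x * a⁻¹ * (⁅a, y⁆ * x) * x⁻¹ * x⁻¹ := by
          simp only [commutatorElement_def]; group
      _ = a * x * a⁻¹ * (x * ⁅a, y⁆) * x⁻¹ * x⁻¹ := by rw [this.eq]
      _ = a * x * a⁻¹ * (x⁻¹ * ((x * (x * ⁅a, y⁆)) * x⁻¹) * x⁻¹) := by group
      _ = ⁅a, x⁆ * ⁅a, y⁆ := by
          rw [← this.eq, ← mul_assoc x, ← this.eq]; simp only [commutatorElement_def]; group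
  have hpow : ∀ a ∈ U.lowerCentralSeries c, ∀ x ∈ U, ∀ n : ℕ, ⁅a, x ^ n⁆ = ⁅a, x⁆ ^ n := by
    intro a ha x hx n
    induction n with
    | zero => simp
    | succ n ih => rw [pow_succ, hmul a ha _ (U.pow_mem hx n) _ hx, ih, pow_succ]
  have key : ∀ a ∈ U.lowerCentralSeries c, ∀ v ∈ V, ⁅a, v⁆ ∈ B := by
    intro a ha v hv
    induction hv using Subgroup.closure_induction with
    | mem v hv =>
      obtain ⟨y, hy, rfl⟩ := hv
      exact ⟨⁅a, y⁆, Subgroup.commutator_mem_commutator ha hy, (hpow a ha y hy q).symm⟩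
    | one => rw [commutatorElement_one_right]; exact B.one_mem
    | mul x y hx hy ihx ihy =>
      rw [hmul a ha x (hVU hx) y (hVU hy)]; exact B.mul_mem ihx ihy
    | inv x hx ih =>
      have := hmul a ha x (hVU hx) x⁻¹ (U.inv_mem (hVU hx))
      rw [mul_inv_cancel, commutatorElement_one_right] at this
      rw [eq_inv_of_mul_eq_one_right this.symm]
      exact B.inv_mem ih
  have hle : V.lowerCentralSeries (c + 1) ≤ B := by
    rw [Subgroup.lowerCentralSeries_succ, Subgroup.commutator_le]
    intro a ha v hv
    exact key a (Subgroup.lowerCentralSeries_mono c hVU ha) v hv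
  exact fun x hx => hle hx

/-- In a nilpotent group of class at most `c`, a product of `q ^ c`-th powers is a `q`-th power. -/
theorem exists_pow_eq_of_mem_closure_pow (q c : ℕ) :
    ∀ (P : Type u) [Group P] (U : Subgroup P), U.Normal → U.lowerCentralSeries c = ⊥ →
      ∀ x ∈ Subgroup.closure {x | ∃ y ∈ U, y ^ q ^ c = x}, ∃ y ∈ U, y ^ q = x := by
  induction c with
  | zero =>
    intro P _ U _ hU x hx
    refine ⟨1, U.one_mem, ?_⟩
    have : Subgroup.closure {x | ∃ y ∈ U, y ^ q ^ 0 = x} ≤ U := by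
      rw [Subgroup.closure_le]
      rintro _ ⟨y, hy, rfl⟩
      exact U.pow_mem hy _
    have hx' := this hx
    rw [show U = ⊥ from hU, Subgroup.mem_bot] at hx'
    rw [hx', one_pow]
  | succ c ih =>
    intro P _ U hUn hU x hx
    have hcen : U.lowerCentralSeries c ≤ Subgroup.centralizer (U : Set P) := by
      intro a ha
      rw [Subgroup.mem_centralizer_iff]
      intro u hu
      have : ⁅a, u⁆ ∈ U.lowerCentralSeries (c + 1) := Subgroup.commutator_mem_commutator ha hu
      rw [hU, Subgroup.mem_bot, commutatorElement_eq_one_iff_mul_comm] at this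
      exact this.symm
    set V := Subgroup.closure {x | ∃ y ∈ U, y ^ q = x} with hV
    have hVU : V ≤ U := by
      rw [hV, Subgroup.closure_le]
      rintro _ ⟨y, hy, rfl⟩
      exact U.pow_mem hy q
    have hVn : V.Normal := by
      refine ⟨fun v hv g => ?_⟩
      induction hv using Subgroup.closure_induction with
      | mem v hv =>
        obtain ⟨y, hy, rfl⟩ := hv
        refine Subgroup.subset_closure ⟨g * y * g⁻¹, hUn.conj_mem y hy g, ?_⟩
        rw [conj_pow]
      | one => simp
      | mul x y _ _ hx hy =>
        have := V.mul_mem hx hy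
        have e : g * (x * y) * g⁻¹ = g * x * g⁻¹ * (g * y * g⁻¹) := by group
        rw [e]; exact this
      | inv x _ hx =>
        have := V.inv_mem hx
        have e : g * x⁻¹ * g⁻¹ = (g * x * g⁻¹)⁻¹ := by group
        rw [e]; exact this
    set L := V.lowerCentralSeries c with hL
    have hLpow : ∀ w ∈ L, ∃ v ∈ U.lowerCentralSeries c, v ^ q = w := by
      rcases c with _ | c
      · have hcomm : ∀ x ∈ U, ∀ y ∈ U, Commute x y := fun x hx y hy =>
          (Subgroup.mem_centralizer_iff.1 (hcen hx) y hy).symm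
        intro w hw
        induction hw using Subgroup.closure_induction with
        | mem v hv => exact hv
        | one => exact ⟨1, U.one_mem, one_pow q⟩
        | mul x y _ _ ihx ihy =>
          obtain ⟨a, ha, rfl⟩ := ihx
          obtain ⟨b, hb, rfl⟩ := ihy
          exact ⟨a * b, U.mul_mem ha hb, (hcomm a ha b hb).mul_pow q⟩
        | inv x _ ih =>
          obtain ⟨a, ha, rfl⟩ := ih
          exact ⟨a⁻¹, U.inv_mem ha, inv_pow a q⟩
      · exact lowerCentralSeries_closure_pow_le U q c hcen
    have hLn : L.Normal := Subgroup.lowerCentralSeries_normal V c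
    let π := QuotientGroup.mk' L
    have hπ : Function.Surjective π := QuotientGroup.mk'_surjective L
    -- A q^(c+1)-th power is the q^c-th power of an element of V, and V / L has class at most c. So
    -- x = y ^ q * w with w in L, and w = v ^ q with v commuting with y; hence x = (y * v) ^ q.
    obtain ⟨yb, hyb, hyx⟩ := ih (P ⧸ L) (V.map π) (hVn.map π hπ)
      (by
        rw [← Subgroup.map_lowerCentralSeries, Subgroup.map_eq_bot_iff, QuotientGroup.ker_mk'])
      (π x) (by
        have : Subgroup.closure {x | ∃ y ∈ U, y ^ q ^ (c + 1) = x} ≤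
            (Subgroup.closure {x | ∃ y ∈ V.map π, y ^ q ^ c = x}).comap π := by
          rw [Subgroup.closure_le]
          rintro _ ⟨y, hy, rfl⟩
          refine Subgroup.subset_closure ⟨π (y ^ q), Subgroup.mem_map_of_mem _
            (Subgroup.subset_closure ⟨y, hy, rfl⟩), ?_⟩
          rw [← map_pow, ← pow_mul, pow_succ, mul_comm]
        exact this hx)
    obtain ⟨y, hy, rfl⟩ := hyb
    rw [← map_pow] at hyx
    obtain ⟨v, hv, hvx⟩ := hLpow _ (QuotientGroup.eq.1 hyx)
    have hvU : v ∈ U := Subgroup.lowerCentralSeries_le_self U c hv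
    refine ⟨y * v, U.mul_mem (hVU hy) hvU, ?_⟩
    have : Commute y v := Subgroup.mem_centralizer_iff.1 (hcen hv) y (hVU hy)
    rw [this.mul_pow, hvx, mul_inv_cancel_left]

/-! ### Word length and distortion -/

/-- `g` is a product of at most `n` letters from `S ∪ S⁻¹`. -/
def LenLE {G : Type*} [Group G] (S : Set G) (n : ℕ) (g : G) : Prop :=
  ∃ l : List G, l.length ≤ n ∧ (∀ x ∈ l, x ∈ S ∨ x⁻¹ ∈ S) ∧ l.prod = g

namespace LenLE

variable {G : Type*} [Group G] {S T : Set G} {m n : ℕ} {g h : G}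

theorem one (S : Set G) (n : ℕ) : LenLE S n (1 : G) := ⟨[], by simp, by simp, rfl⟩

theorem of_mem (hg : g ∈ S) : LenLE S 1 g := ⟨[g], by simp, by simp [hg], by simp⟩

theorem mono (h : LenLE S m g) (hmn : m ≤ n) : LenLE S n g := by
  obtain ⟨l, hl, h⟩ := h
  exact ⟨l, hl.trans hmn, h⟩

theorem mul (hg : LenLE S m g) (hh : LenLE S n h) : LenLE S (m + n) (g * h) := by
  obtain ⟨l, hl, hlS, rfl⟩ := hg
  obtain ⟨k, hk, hkS, rfl⟩ := hh
  refine ⟨l ++ k, by rw [List.length_append]; omega, fun x hx => ?_, List.prod_append⟩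
  rcases List.mem_append.1 hx with hx | hx
  · exact hlS x hx
  · exact hkS x hx

theorem inv (hg : LenLE S n g) : LenLE S n g⁻¹ := by
  obtain ⟨l, hl, hlS, rfl⟩ := hg
  refine ⟨(l.map (·⁻¹)).reverse, by simpa using hl, fun x hx => ?_, by
    rw [List.prod_inv_reverse]⟩
  simp only [List.mem_reverse, List.mem_map] at hx
  obtain ⟨y, hy, rfl⟩ := hx
  rw [inv_inv]
  exact (hlS y hy).symm

theorem pow (hg : LenLE S n g) (k : ℕ) : LenLE S (k * n) (g ^ k) := by
  induction k with
  | zero => simpa using one S 0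
  | succ k ih => rw [pow_succ, Nat.succ_mul]; exact ih.mul hg

theorem zpow (hg : LenLE S n g) (k : ℤ) : LenLE S (k.natAbs * n) (g ^ k) := by
  rcases Int.natAbs_eq k with h | h
  · rw [h, zpow_natCast, Int.natAbs_natCast]; exact hg.pow _
  · rw [h, zpow_neg, zpow_natCast, Int.natAbs_neg, Int.natAbs_natCast]; exact (hg.pow _).inv

/-- Induction on words by adding letters at the end. -/
theorem induction {P : ℕ → G → Prop} (h1 : P 0 1)
    (hmul : ∀ n g x, P n g → (x ∈ S ∨ x⁻¹ ∈ S) → P (n + 1) (g * x))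
    (hmono : ∀ m n g, m ≤ n → P m g → P n g) (hg : LenLE S n g) : P n g := by
  obtain ⟨l, hl, hlS, rfl⟩ := hg
  refine hmono _ _ _ hl ?_
  clear hl
  induction l using List.reverseRecOn with
  | nil => exact h1
  | append_singleton l x ih =>
    rw [List.prod_append, List.prod_singleton, List.length_append, List.length_singleton]
    exact hmul _ _ _ (ih fun y hy => hlS y (by simp [hy])) (hlS x (by simp))

theorem mem_closure (hg : LenLE S n g) : g ∈ Subgroup.closure S := by
  obtain ⟨l, hl, hlS, rfl⟩ := hg
  refine Subgroup.list_prod_mem _ fun x hx => ?_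
  rcases hlS x hx with h | h
  · exact Subgroup.subset_closure h
  · exact inv_inv x ▸ Subgroup.inv_mem _ (Subgroup.subset_closure h)

theorem exists_of_mem_closure (hg : g ∈ Subgroup.closure S) : ∃ n, LenLE S n g := by
  induction hg using Subgroup.closure_induction with
  | mem x hx => exact ⟨1, of_mem hx⟩
  | one => exact ⟨0, one S 0⟩
  | mul x y _ _ hx hy =>
    obtain ⟨a, ha⟩ := hx
    obtain ⟨b, hb⟩ := hy
    exact ⟨a + b, ha.mul hb⟩
  | inv x _ hx =>
    obtain ⟨a, ha⟩ := hx
    exact ⟨a, ha.inv⟩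

theorem trans {C : ℕ} (hS : ∀ s ∈ S, LenLE T C s) (hg : LenLE S n g) : LenLE T (n * C) g := by
  refine hg.induction (P := fun n g => LenLE T (n * C) g) (one T _) ?_ ?_
  · intro n g x hg hx
    rw [Nat.succ_mul]
    refine hg.mul ?_
    rcases hx with hx | hx
    · exact hS x hx
    · exact inv_inv x ▸ (hS _ hx).inv
  · intro m n g hmn h
    exact h.mono (Nat.mul_le_mul_right C hmn)

theorem exists_bound (hS : S.Finite) (hST : S ⊆ Subgroup.closure T) :
    ∃ C, ∀ s ∈ S, LenLE T C s := by
  have : ∀ s ∈ S, ∃ n, LenLE T n s := fun s hs => exists_of_mem_closure (hST hs)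
  choose! f hf using this
  obtain ⟨C, hC⟩ := (hS.image f).bddAbove
  exact ⟨C, fun s hs => (hf s hs).mono (hC ⟨s, hs, rfl⟩)⟩

theorem map {H : Type*} [Group H] (f : G →* H) (hg : LenLE S n g) : LenLE (f '' S) n (f g) := by
  obtain ⟨l, hl, hlS, rfl⟩ := hg
  refine ⟨l.map f, by simpa using hl, fun x hx => ?_, (map_list_prod f l).symm⟩
  obtain ⟨y, hy, rfl⟩ := List.mem_map.1 hx
  rcases hlS y hy with h | h
  · exact Or.inl ⟨y, h, rfl⟩
  · exact Or.inr ⟨_, h, map_inv f y⟩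

end LenLE

/-- `H` is at most polynomially distorted in `K`. -/
def PolyDistorted {G : Type*} [Group G] (K H : Subgroup G) : Prop :=
  ∀ S : Set G, S.Finite → S ⊆ K → ∃ T : Set G, T.Finite ∧ T ⊆ H ∧ ∃ C c : ℕ, ∀ n g, g ∈ H →
    LenLE S n g → LenLE T (C * (n + 1) ^ c) g

theorem PolyDistorted.trans {G : Type*} [Group G] {K H J : Subgroup G} (h1 : PolyDistorted K H)
    (h2 : PolyDistorted H J) (hJH : J ≤ H) : PolyDistorted K J := by
  intro S hS hSK
  obtain ⟨T, hT, hTH, C, c, h⟩ := h1 S hS hSK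
  obtain ⟨T', hT', hTJ, C', c', h'⟩ := h2 T hT hTH
  refine ⟨T', hT', hTJ, C' * (C + 1) ^ c', c * c', fun n g hg hn => ?_⟩
  refine (h' _ g hg (h n g (hJH hg) hn)).mono ?_
  rw [mul_assoc, pow_mul, ← mul_pow]
  gcongr
  have : 1 ≤ (n + 1) ^ c := Nat.one_le_pow _ _ (by omega)
  nlinarith

/-- Conjugation by powers of a fixed element changes the word length in a normal subgroup of a
nilpotent group by at most a polynomial. -/
theorem exists_len_conj_pow_le {G : Type*} [Group G] (H : Subgroup G) [H.Normal] (T : Set G)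
    (hT : Subgroup.closure T = H) (t : G) (j : ℕ) :
    ∀ u ∈ H ⊓ Subgroup.upperCentralSeries G j,
      ∃ C c : ℕ, ∀ b : ℕ, LenLE T (C * (b + 1) ^ c) (t ^ b * u * (t ^ b)⁻¹) := by
  induction j with
  | zero =>
    intro u hu
    have : u = 1 := by simpa using hu.2
    exact ⟨0, 0, fun b => by rw [this]; simpa using LenLE.one T 0⟩
  | succ j ih =>
    intro u hu
    obtain ⟨m, hm⟩ := LenLE.exists_of_mem_closure (hT.symm ▸ hu.1 : u ∈ Subgroup.closure T)
    -- This commutator lies one step lower in the upper central series. Conjugating u by t^(b+1)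
    -- costs the conjugate by t^b plus the t^b-conjugate of the commutator; summing the latter over
    -- b raises the degree by one.
    have hv : u⁻¹ * (t * u * t⁻¹) ∈ H ⊓ Subgroup.upperCentralSeries G j := by
      refine ⟨H.mul_mem (H.inv_mem hu.1) (Subgroup.Normal.conj_mem inferInstance u hu.1 t), ?_⟩
      have := Subgroup.mem_upperCentralSeries_succ_iff.1 (Subgroup.inv_mem _ hu.2) t
      simpa [commutatorElement_def, mul_assoc] using this
    obtain ⟨C, c, h⟩ := ih _ hv
    refine ⟨C + m, c + 1, fun b => ?_⟩
    induction b with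
    | zero => simpa using hm.mono (Nat.le_add_left m C)
    | succ b ihb =>
      have e : t ^ (b + 1) * u * (t ^ (b + 1))⁻¹ = t ^ b * u * (t ^ b)⁻¹ *
          (t ^ b * (u⁻¹ * (t * u * t⁻¹)) * (t ^ b)⁻¹) := by
        rw [pow_succ]; group
      rw [e]
      refine (ihb.mul (h b)).mono ?_
      have h1 : (b + 1) ^ c ≤ (b + 1 + 1) ^ c := Nat.pow_le_pow_left (by omega) c
      calc (C + m) * (b + 1) ^ (c + 1) + C * (b + 1) ^ c
          = ((C + m) * (b + 1) + C) * (b + 1) ^ c := by ring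
        _ ≤ ((C + m) * (b + 1 + 1)) * (b + 1 + 1) ^ c := by
            apply Nat.mul_le_mul _ h1; nlinarith
        _ = _ := by ring

theorem exists_len_conj_zpow_le {G : Type*} [Group G] [hG : Group.IsNilpotent G] (H : Subgroup G)
    [H.Normal] (T : Set G) (hT : Subgroup.closure T = H) (t : G) :
    ∀ u ∈ H, ∃ C c : ℕ, ∀ b : ℤ, LenLE T (C * (b.natAbs + 1) ^ c) (t ^ b * u * (t ^ b)⁻¹) := by
  intro u hu
  obtain ⟨j, hj⟩ := Group.IsNilpotent.nilpotent G
  have hu' : u ∈ H ⊓ Subgroup.upperCentralSeries G j := by rw [hj]; exact ⟨hu, Subgroup.mem_top u⟩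
  obtain ⟨C₁, c₁, h₁⟩ := exists_len_conj_pow_le H T hT t j u hu'
  obtain ⟨C₂, c₂, h₂⟩ := exists_len_conj_pow_le H T hT t⁻¹ j u hu'
  refine ⟨C₁ + C₂, c₁ + c₂, fun b => ?_⟩
  have hp : 1 ≤ b.natAbs + 1 := by omega
  rcases Int.natAbs_eq b with h | h
  · rw [h, zpow_natCast, Int.natAbs_natCast]
    exact (h₁ _).mono (Nat.mul_le_mul (by omega) (Nat.pow_le_pow_right hp (by omega)))
  · rw [h, zpow_neg, zpow_natCast, Int.natAbs_neg, Int.natAbs_natCast, ← inv_pow]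
    exact (h₂ _).mono (Nat.mul_le_mul (by omega) (Nat.pow_le_pow_right hp (by omega)))

/-- Collect powers of t to the right: a word becomes h * t ^ b, where each letter from H that
crosses a power of t is replaced by a conjugate of polynomial length. If the product lies in H, so
does t ^ b, which is then a power of the fixed element t ^ o. -/
theorem polyDistorted_of_cyclic {G : Type*} [Group G] [Group.IsNilpotent G] (K H : Subgroup G)
    [H.Normal] (hH : H.FG) (t : G) (hK : K = H ⊔ Subgroup.zpowers t) : PolyDistorted K H := by
  obtain ⟨T₀, hT₀, hfin₀⟩ := (Subgroup.fg_iff H).1 hH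
  -- the least power of `t` in `H`
  obtain ⟨o, ho⟩ : ∃ o : ℤ, ∀ b : ℤ, t ^ b ∈ H ↔ o ∣ b := by
    obtain ⟨o, ho⟩ := Int.subgroup_cyclic
      (AddSubgroup.comap (zmultiplesHom (Additive G) (Additive.ofMul t)) H.toAddSubgroup)
    refine ⟨o, fun b => ?_⟩
    have h1 : t ^ b ∈ H ↔
        b ∈ AddSubgroup.comap (zmultiplesHom (Additive G) (Additive.ofMul t)) H.toAddSubgroup :=
      Iff.rfl
    rw [h1, ho, ← AddSubgroup.zmultiples_eq_closure, Int.mem_zmultiples_iff]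
  intro S hS hSK
  have hconj : ∀ u ∈ T₀, ∃ C c : ℕ, ∀ b : ℤ,
      LenLE T₀ (C * (b.natAbs + 1) ^ c) (t ^ b * u * (t ^ b)⁻¹) := fun u hu =>
    exists_len_conj_zpow_le H T₀ hT₀ t u (hT₀ ▸ Subgroup.subset_closure hu)
  choose! C c hCc using hconj
  obtain ⟨C₁, hC₁⟩ := (hfin₀.image C).bddAbove
  obtain ⟨c₁, hc₁⟩ := (hfin₀.image c).bddAbove
  have hconj' : ∀ u ∈ T₀, ∀ b : ℤ, LenLE T₀ (C₁ * (b.natAbs + 1) ^ c₁) (t ^ b * u * (t ^ b)⁻¹) :=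
    fun u hu b => (hCc u hu b).mono (Nat.mul_le_mul (hC₁ ⟨u, hu, rfl⟩)
      (Nat.pow_le_pow_right (by omega) (hc₁ ⟨u, hu, rfl⟩)))
  obtain ⟨D, hD⟩ := LenLE.exists_bound (T := insert t T₀) hS (by
    refine hSK.trans ?_
    rw [hK, ← hT₀, Subgroup.zpowers_eq_closure, ← Subgroup.closure_union]
    exact Subgroup.closure_mono (by
      rw [Set.union_singleton]))
  obtain ⟨E, hE⟩ : ∃ E, LenLE T₀ E (t ^ o) := LenLE.exists_of_mem_closure (by
    rw [hT₀]; exact (ho o).2 dvd_rfl)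
  have key : ∀ n g, LenLE (insert t T₀) n g → ∃ h : G, ∃ b : ℤ, g = h * t ^ b ∧ b.natAbs ≤ n ∧
      LenLE T₀ (n * (C₁ * (n + 1) ^ c₁)) h := by
    intro n g hg
    refine hg.induction (P := fun n g => ∃ h : G, ∃ b : ℤ, g = h * t ^ b ∧ b.natAbs ≤ n ∧
      LenLE T₀ (n * (C₁ * (n + 1) ^ c₁)) h) ⟨1, 0, by simp, by simp, LenLE.one _ _⟩ ?_ ?_
    · rintro n _ x ⟨h, b, rfl, hb, hh⟩ hx
      have hle : n * (C₁ * (n + 1) ^ c₁) ≤ n * (C₁ * (n + 1 + 1) ^ c₁) := by gcongr; omega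
      have hle2 : C₁ * (b.natAbs + 1) ^ c₁ ≤ C₁ * (n + 1 + 1) ^ c₁ := by gcongr; omega
      have hle3 : n * (C₁ * (n + 1 + 1) ^ c₁) ≤ (n + 1) * (C₁ * (n + 1 + 1) ^ c₁) := by
        gcongr; omega
      have hle4 : n * (C₁ * (n + 1) ^ c₁) + C₁ * (b.natAbs + 1) ^ c₁ ≤
          (n + 1) * (C₁ * (n + 1 + 1) ^ c₁) := by
        rw [Nat.succ_mul]; exact Nat.add_le_add hle hle2
      rcases hx with hx | hx
      · rcases hx with rfl | hx
        · exact ⟨h, b + 1, by rw [zpow_add_one, mul_assoc], by omega, hh.mono (hle.trans hle3)⟩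
        · refine ⟨h * (t ^ b * x * (t ^ b)⁻¹), b, by group, by omega, ?_⟩
          exact (hh.mul (hconj' x hx b)).mono hle4
      · rcases hx with hx | hx
        · refine ⟨h, b - 1, ?_, by omega, hh.mono (hle.trans hle3)⟩
          rw [zpow_sub_one, mul_assoc, ← hx, inv_inv]
        · refine ⟨h * (t ^ b * x * (t ^ b)⁻¹), b, by group, by omega, ?_⟩
          have := (hconj' _ hx b).inv
          have e : (t ^ b * x⁻¹ * (t ^ b)⁻¹)⁻¹ = t ^ b * x * (t ^ b)⁻¹ := by group
          rw [e] at this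
          exact (hh.mul this).mono hle4
    · rintro m n g hmn ⟨h, b, hg, hb, hh⟩
      exact ⟨h, b, hg, hb.trans hmn, hh.mono (by gcongr)⟩
  refine ⟨T₀, hfin₀, hT₀ ▸ Subgroup.subset_closure, (D + 1) * (C₁ * (D + 1) ^ c₁ + E), c₁ + 1,
    fun n g hg hn => ?_⟩
  obtain ⟨h, b, rfl, hb, hh⟩ := key _ _ (hn.trans hD)
  have hhH : h ∈ H := hT₀ ▸ hh.mem_closure
  have hbH : t ^ b ∈ H := by
    have := H.mul_mem (H.inv_mem hhH) hg
    rwa [inv_mul_cancel_left] at this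
  obtain ⟨e, rfl⟩ := (ho b).1 hbH
  have hlen : LenLE T₀ (n * D * E) (t ^ (o * e)) := by
    by_cases ho0 : o = 0
    · subst ho0; simpa using LenLE.one T₀ _
    · rw [zpow_mul]
      refine (hE.zpow e).mono (Nat.mul_le_mul_right E (le_trans ?_ hb))
      rw [Int.natAbs_mul]
      exact Nat.le_mul_of_pos_left _ (Int.natAbs_pos.2 ho0)
  refine (hh.mul hlen).mono ?_
  have h1 : n * D + 1 ≤ (D + 1) * (n + 1) := by nlinarith
  have h2 : (n * D + 1) ^ c₁ ≤ (D + 1) ^ c₁ * (n + 1) ^ c₁ := by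
    rw [← mul_pow]; exact Nat.pow_le_pow_left h1 c₁
  have h3 : 1 ≤ (n + 1) ^ c₁ := Nat.one_le_pow _ _ (by omega)
  have h4 : n * D ≤ (D + 1) * (n + 1) := by omega
  calc n * D * (C₁ * (n * D + 1) ^ c₁) + n * D * E
      ≤ (D + 1) * (n + 1) * (C₁ * ((D + 1) ^ c₁ * (n + 1) ^ c₁)) +
        (D + 1) * (n + 1) * (E * (n + 1) ^ c₁) := by
        gcongr
        exact Nat.le_mul_of_pos_right _ h3
    _ = (D + 1) * (C₁ * (D + 1) ^ c₁ + E) * (n + 1) ^ (c₁ + 1) := by ring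

/-- Along the series of Q, the kernel of p ∘ f is generated by the kernel of f and one preimage t of
z. Each step is a cyclic extension, and polynomial distortions compose. -/
theorem CentralCyclicSeries.polyDistorted_ker {h : ℕ} {Q : Type u} [Group Q]
    (hQ : CentralCyclicSeries h Q) {P : Type*} [Group P] [Group.IsNilpotent P]
    (hP : ∀ K : Subgroup P, K.FG) :
    ∀ f : P →* Q, Function.Surjective f → PolyDistorted ⊤ f.ker := by
  induction hQ with
  | base Q hQ =>
    intro f _ S hS _
    refine ⟨S, hS, ?_, 1, 1, fun n g _ hg => hg.mono (by rw [pow_one]; omega)⟩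
    intro x _
    exact Subsingleton.elim _ _
  | extend h Q Q' p hp z hz hker hQ' ih =>
    intro f hf
    obtain ⟨t, rfl⟩ := hf z
    refine (ih (p.comp f) (hp.comp hf)).trans
      (polyDistorted_of_cyclic _ _ (hP _) t (le_antisymm ?_ ?_)) ?_
    · intro x hx
      have : f x ∈ p.ker := hx
      rw [hker] at this
      obtain ⟨n, hn⟩ := Subgroup.mem_zpowers_iff.1 this
      have : x * (t ^ n)⁻¹ ∈ f.ker := by
        rw [MonoidHom.mem_ker, map_mul, map_inv, map_zpow, hn, mul_inv_cancel]
      have := Subgroup.mul_mem_sup this (Subgroup.zpow_mem_zpowers t n)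
      simpa using this
    · rw [sup_le_iff, Subgroup.zpowers_le]
      refine ⟨fun x hx => ?_, ?_⟩
      · show p (f x) = 1
        rw [show f x = 1 from hx, map_one]
      · show f t ∈ p.ker
        rw [hker]; exact Subgroup.mem_zpowers _
    · intro x hx
      show p (f x) = 1
      rw [show f x = 1 from hx, map_one]

theorem PolyDistorted.exists_zpow {G : Type*} [Group G] {z : G}
    (h : PolyDistorted ⊤ (Subgroup.zpowers z)) (S : Set G) (hS : S.Finite) :
    ∃ C c : ℕ, ∀ n g, g ∈ Subgroup.zpowers z → LenLE S n g →
      ∃ e : ℤ, g = z ^ e ∧ e.natAbs ≤ C * (n + 1) ^ c := by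
  obtain ⟨T, hT, hTz, C, c, hC⟩ := h S hS (Set.subset_univ S)
  obtain ⟨D, hD⟩ := LenLE.exists_bound (T := {z}) hT (by
    rwa [← Subgroup.zpowers_eq_closure])
  refine ⟨C * D, c, fun n g hg hn => ?_⟩
  have h1 := (hC n g hg hn).trans hD
  have key : ∀ m g, LenLE {z} m g → ∃ e : ℤ, g = z ^ e ∧ e.natAbs ≤ m := by
    intro m g hg
    refine hg.induction (P := fun m g => ∃ e : ℤ, g = z ^ e ∧ e.natAbs ≤ m)
      ⟨0, by simp, by simp⟩ ?_ ?_
    · rintro n _ x ⟨e, rfl, he⟩ hx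
      rcases hx with hx | hx
      · rw [Set.mem_singleton_iff] at hx
        subst hx
        exact ⟨e + 1, by rw [zpow_add_one], by omega⟩
      · rw [Set.mem_singleton_iff] at hx
        exact ⟨e - 1, by rw [zpow_sub_one, ← hx, inv_inv], by omega⟩
    · rintro m n g hmn ⟨e, hg, he⟩
      exact ⟨e, hg, he.trans hmn⟩
  obtain ⟨e, he, hle⟩ := key _ _ h1
  exact ⟨e, he, hle.trans (by rw [mul_right_comm])⟩

/-! ### Small non-divisors -/

/-- Every prime power in the central binomial coefficient of m is at most 2m. If all numbers up to
2m divided E, so would that coefficient, which exceeds 4^m / m > 2^m > E. -/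
theorem exists_not_dvd_le_log (E : ℕ) (hE : E ≠ 0) :
    ∃ q : ℕ, 0 < q ∧ q ≤ 4 * (Nat.log 2 E + 5) ∧ ¬ q ∣ E := by
  by_contra! hcon
  set m := 2 * (Nat.log 2 E + 5) with hm
  have hdvd : Nat.centralBinom m ∣ E := by
    rw [← Nat.factorization_prime_le_iff_dvd (Nat.centralBinom_ne_zero m) hE]
    intro p hp
    rw [← hp.pow_dvd_iff_le_factorization hE]
    apply hcon _ (pow_pos hp.pos _)
    refine (Nat.pow_factorization_choose_le ?_).trans ?_ <;> omega
  have h1 := Nat.le_of_dvd (Nat.pos_of_ne_zero hE) hdvd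
  have h2 : 4 ^ m < m * Nat.centralBinom m := Nat.four_pow_lt_mul_centralBinom m (by omega)
  have h3 : m < 2 ^ m := Nat.lt_two_pow_self
  have h4 : E < 2 ^ (Nat.log 2 E + 1) := Nat.lt_pow_succ_log_self (by norm_num) E
  have h5 : 2 ^ (Nat.log 2 E + 1) ≤ 2 ^ m := Nat.pow_le_pow_right (by norm_num) (by omega)
  have h6 : (4 : ℕ) ^ m = 2 ^ m * 2 ^ m := by rw [← mul_pow]; norm_num
  have h7 : m * Nat.centralBinom m ≤ 2 ^ m * 2 ^ m := by
    apply Nat.mul_le_mul h3.le; omega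
  omega

/-! ### Quantitative residual finiteness of nilpotent groups -/

/-- Nontrivial elements of length `n` survive in a normal subgroup quotient of order polynomial in
`log n`. -/
def PolylogRF (G : Type*) [Group G] : Prop :=
  ∀ S : Set G, S.Finite → ∃ C k : ℕ, ∀ n g, g ≠ 1 → LenLE S n g →
    ∃ M : Subgroup G, M.Normal ∧ g ∉ M ∧ M.index ≠ 0 ∧ M.index ≤ C * (Nat.log 2 (n + 1) + 1) ^ k

theorem CentralCyclicSeries.isNilpotent {h : ℕ} {P : Type u} [Group P]
    (hP : CentralCyclicSeries h P) : Group.IsNilpotent P := by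
  induction hP with
  | base P hP => infer_instance
  | extend h P Q f hf z hz hker hQ ih =>
    refine Subgroup.isNilpotent_of_ker_le_center f ?_
    rwa [hker, Subgroup.zpowers_le]

/-- M is generated by the q^c-th powers: it contains only q-th powers, hence not g, while the
quotient has exponent q^c and so bounded order. -/
theorem CentralCyclicSeries.exists_normal_notMem {h : ℕ} {P : Type u} [Group P]
    (hP : CentralCyclicSeries h P) {c : ℕ} (hc : (⊤ : Subgroup P).lowerCentralSeries c = ⊥)
    {q : ℕ} (hq : 0 < q) (g : P) (hg : ∀ y, y ^ q ≠ g) :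
    ∃ M : Subgroup P, M.Normal ∧ g ∉ M ∧ M.index ≠ 0 ∧ M.index ≤ (q ^ c) ^ h := by
  set M := Subgroup.closure {x : P | ∃ y ∈ (⊤ : Subgroup P), y ^ q ^ c = x} with hM
  have hMn : M.Normal := by
    refine ⟨fun v hv g => ?_⟩
    induction hv using Subgroup.closure_induction with
    | mem v hv =>
      obtain ⟨y, hy, rfl⟩ := hv
      exact Subgroup.subset_closure ⟨g * y * g⁻¹, Subgroup.mem_top _, conj_pow⟩
    | one => simp
    | mul x y _ _ hx hy =>
      have e : g * (x * y) * g⁻¹ = g * x * g⁻¹ * (g * y * g⁻¹) := by group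
      rw [e]; exact M.mul_mem hx hy
    | inv x _ hx =>
      have e : g * x⁻¹ * g⁻¹ = (g * x * g⁻¹)⁻¹ := by group
      rw [e]; exact M.inv_mem hx
  obtain ⟨hfin, hcard⟩ := hP.card_le_of_exponent (q ^ c) (pow_pos hq c) (P ⧸ M)
    (QuotientGroup.mk' M) (QuotientGroup.mk'_surjective M) (fun x => by
      induction x using QuotientGroup.induction_on with
      | H x =>
        rw [← QuotientGroup.mk_pow, QuotientGroup.eq_one_iff]
        exact Subgroup.subset_closure ⟨x, Subgroup.mem_top x, rfl⟩)
  refine ⟨M, hMn, fun hgM => ?_, Subgroup.index_ne_zero_of_finite, hcard⟩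
  obtain ⟨y, _, hy⟩ := exists_pow_eq_of_mem_closure_pow q c P ⊤ inferInstance hc g hgM
  exact hg y hy

theorem CentralCyclicSeries.polylogRF {h : ℕ} {P : Type u} [Group P]
    (hP : CentralCyclicSeries h P) : PolylogRF P := by
  induction hP with
  | base P hP => exact fun S _ => ⟨0, 0, fun n g hg => absurd (Subsingleton.elim g 1) hg⟩
  | extend h P Q f hf z hz hker hQ ih =>
    intro S hS
    have hP := CentralCyclicSeries.extend h P Q f hf z hz hker hQ
    have hnil := hP.isNilpotent
    obtain ⟨c, hc⟩ := Subgroup.nilpotent_iff_lowerCentralSeries.1 hnil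
    obtain ⟨C₁, k₁, h₁⟩ := ih (f '' S) (hS.image f)
    obtain ⟨K, hK, hKtors⟩ := hQ.exists_torsion_exponent
    obtain ⟨K', hK', hKtors'⟩ := hP.exists_torsion_exponent
    have hdist := hQ.polyDistorted_ker hP.subgroup_fg f hf
    rw [hker] at hdist
    obtain ⟨D, d, hD⟩ := hdist.exists_zpow S hS
    obtain ⟨A, hA⟩ : ∃ A, D * K ≤ 2 ^ A := ⟨D * K, Nat.lt_two_pow_self.le⟩
    -- With x = log₂(n + 1) + 1 (rounded down), the exponent satisfies |e| * K ≤ 2 ^ (A + d * x), so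
    -- the non-divisor q found below is at most 4 * (A + d * x + 5) ≤ B * x.
    set B := 4 * (A + d + 5) with hB
    refine ⟨C₁ + (K' ^ c) ^ (h + 1) + B ^ (c * (h + 1)), k₁ + c * (h + 1), fun n g hg hn => ?_⟩
    set x := Nat.log 2 (n + 1) + 1 with hx
    have hx1 : 1 ≤ x := by omega
    by_cases hgz : g ∈ f.ker
    · rw [hker] at hgz
      obtain ⟨e, rfl, he⟩ := hD n g hgz hn
      by_cases hzo : IsOfFinOrder z
      -- A K'-th root of the torsion element z ^ e would itself be torsion, hence killed by K',
      -- forcing z ^ e = 1.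
      · obtain ⟨M, hM, hgM, hM0, hMi⟩ := hP.exists_normal_notMem hc hK' (z ^ e) (fun y hy => by
          have hy' : IsOfFinOrder y := by
            obtain ⟨m, hm, hm1⟩ := isOfFinOrder_iff_pow_eq_one.1 hzo
            refine isOfFinOrder_iff_pow_eq_one.2 ⟨K' * m, Nat.mul_pos hK' hm, ?_⟩
            rw [pow_mul, hy, ← zpow_natCast, ← zpow_mul, mul_comm, zpow_mul, zpow_natCast, hm1,
              one_zpow]
          exact hg (by rw [← hy, hKtors' y hy']))
        refine ⟨M, hM, hgM, hM0, hMi.trans ?_⟩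
        calc (K' ^ c) ^ (h + 1) ≤ C₁ + (K' ^ c) ^ (h + 1) + B ^ (c * (h + 1)) := by omega
          _ ≤ _ := Nat.le_mul_of_pos_right _ (pow_pos hx1 _)
      · have he0 : e ≠ 0 := fun h0 => hg (by rw [h0, zpow_zero])
        -- The factor K accounts for torsion in Q: if y ^ q = z ^ e, then f y is torsion, so y ^ K =
        -- z ^ r for some r, and comparing exponents gives e * K = r * q.
        obtain ⟨q, hq, hqle, hqE⟩ := exists_not_dvd_le_log (e.natAbs * K)
          (Nat.mul_ne_zero (Int.natAbs_ne_zero.2 he0) hK.ne')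
        obtain ⟨M, hM, hgM, hM0, hMi⟩ := hP.exists_normal_notMem hc hq (z ^ e) (fun y hy => by
          have h1 : f y ^ K = 1 := by
            apply hKtors
            refine isOfFinOrder_iff_pow_eq_one.2 ⟨q, hq, ?_⟩
            rw [← map_pow, hy, ← MonoidHom.mem_ker, hker]
            exact Subgroup.zpow_mem_zpowers z e
          rw [← map_pow, ← MonoidHom.mem_ker, hker] at h1
          obtain ⟨r, hr⟩ := Subgroup.mem_zpowers_iff.1 h1
          have h2 : z ^ (e * K) = z ^ (r * q) := by
            rw [zpow_mul, zpow_mul, hr, ← hy, zpow_natCast, zpow_natCast, ← pow_mul, ← pow_mul,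
              mul_comm]
          have h3 := injective_zpow_iff_not_isOfFinOrder.2 hzo h2
          apply hqE
          rw [← Int.natCast_dvd_natCast, Nat.cast_mul]
          have h4 : (q : ℤ) ∣ e * K := ⟨r, by rw [h3, mul_comm]⟩
          rwa [← Int.natAbs_dvd_natAbs, Int.natAbs_mul, ← Int.natCast_dvd_natCast, Nat.cast_mul,
            Int.natAbs_natCast, Int.natAbs_natCast] at h4)
        refine ⟨M, hM, hgM, hM0, hMi.trans ?_⟩
        have hlog : Nat.log 2 (e.natAbs * K) ≤ A + d * x := by
          have h5 : e.natAbs * K ≤ 2 ^ (A + d * x) := by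
            calc e.natAbs * K ≤ D * (n + 1) ^ d * K := Nat.mul_le_mul_right K he
              _ = D * K * (n + 1) ^ d := by ring
              _ ≤ 2 ^ A * (2 ^ x) ^ d := Nat.mul_le_mul hA
                  (Nat.pow_le_pow_left (Nat.lt_pow_succ_log_self (by norm_num) _).le d)
              _ = _ := by rw [← pow_mul, mul_comm x d, ← pow_add]
          calc _ ≤ Nat.log 2 (2 ^ (A + d * x)) := Nat.log_mono_right h5
            _ = _ := Nat.log_pow (by norm_num) _
        have hqx : q ≤ B * x := by
          refine hqle.trans ?_
          rw [hB]; nlinarith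
        calc (q ^ c) ^ (h + 1) ≤ ((B * x) ^ c) ^ (h + 1) := by gcongr
          _ = B ^ (c * (h + 1)) * x ^ (c * (h + 1)) := by rw [← pow_mul, mul_pow]
          _ ≤ _ := Nat.mul_le_mul (by omega) (Nat.pow_le_pow_right hx1 (by omega))
    · obtain ⟨M, hM, hgM, hM0, hMi⟩ := h₁ n (f g) hgz (hn.map f)
      refine ⟨M.comap f, hM.comap f, hgM, ?_, ?_⟩
      · rwa [Subgroup.index_comap_of_surjective _ hf]
      · rw [Subgroup.index_comap_of_surjective _ hf]
        exact hMi.trans (Nat.mul_le_mul (by omega) (Nat.pow_le_pow_right hx1 (by omega)))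

/-- Schreier's lemma with word lengths: finite index subgroups are undistorted. -/
theorem exists_len_le_of_finiteIndex {G : Type*} [Group G] (N : Subgroup G) [N.FiniteIndex]
    (S : Set G) (hS : S.Finite) :
    ∃ T : Set G, T.Finite ∧ T ⊆ N ∧ ∀ n g, g ∈ N → LenLE S n g → LenLE T (n + 2) g := by
  classical
  let τ : G → G := fun g => Quotient.out (g : G ⧸ N)
  have hτ : ∀ g, g⁻¹ * τ g ∈ N := fun g => QuotientGroup.eq.1 (QuotientGroup.out_eq' _).symm
  have hR : (Set.range (fun x : G ⧸ N => (Quotient.out x : G))).Finite := Set.finite_range _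
  set R := Set.range (fun x : G ⧸ N => (Quotient.out x : G))
  have hτR : ∀ g, τ g ∈ R := fun g => ⟨(g : G ⧸ N), rfl⟩
  let T : Set G := ((Set.image2 (fun (p : G × G) (r : G) => p.1⁻¹ * p.2 * r)
    (R ×ˢ (S ∪ S⁻¹)) R) ∩ N) ∪ {τ 1}
  have hτ1 : τ 1 ∈ N := by simpa using hτ 1
  refine ⟨T, ?_, ?_, ?_⟩
  · exact (Set.Finite.inter_of_left
      (Set.Finite.image2 _ (hR.prod (hS.union hS.inv)) hR) _).union (Set.finite_singleton _)
  · rintro x (hx | hx)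
    · exact hx.2
    · rw [Set.mem_singleton_iff] at hx; rw [hx]; exact hτ1
  · intro n g hgN hg
    have h1T : LenLE T 1 (τ 1) := LenLE.of_mem (Or.inr rfl)
    -- Appending a letter to the prefix g multiplies g * τ g⁻¹ by one Schreier generator. As τ 1
    -- need not be 1, it is a letter too: it is used once at the start and removed once at the end,
    -- whence n + 2.
    have key : LenLE T (n + 1) (g * τ g⁻¹) := by
      refine hg.induction (P := fun n g => LenLE T (n + 1) (g * τ g⁻¹)) ?_ ?_ ?_
      · simpa using h1T
      · intro n g x hgx hx
        have e : g * x * τ (g * x)⁻¹ = g * τ g⁻¹ * ((τ g⁻¹)⁻¹ * x * τ (g * x)⁻¹) := by group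
        rw [e]
        refine hgx.mul (LenLE.of_mem (Or.inl ⟨⟨(τ g⁻¹, x), ⟨hτR _, hx⟩, _, hτR _, rfl⟩, ?_⟩))
        have h1 : g * τ g⁻¹ ∈ N := by simpa using hτ g⁻¹
        have h2 : g * x * τ (g * x)⁻¹ ∈ N := by simpa using hτ (g * x)⁻¹
        rw [e] at h2
        exact (Subgroup.mul_mem_cancel_left N h1).1 h2
      · intro m n g hmn h
        exact h.mono (by omega)
    have hτg : τ g⁻¹ = τ 1 := by
      have : ((g⁻¹ : G) : G ⧸ N) = ((1 : G) : G ⧸ N) := QuotientGroup.eq.2 (by simpa using hgN)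
      simp only [τ, this]
    rw [hτg] at key
    have := key.mul h1T.inv
    rwa [mul_inv_cancel_right] at this

theorem LenLE.subtype {G : Type*} [Group G] {N : Subgroup G} {T : Set G} (hT : T ⊆ N) {n : ℕ}
    {g : G} (hg : LenLE T n g) (hgN : g ∈ N) : LenLE (N.subtype ⁻¹' T) n (⟨g, hgN⟩ : N) := by
  have : ∃ h : N, (h : G) = g ∧ LenLE (N.subtype ⁻¹' T) n h := by
    refine hg.induction (P := fun n g => ∃ h : N, (h : G) = g ∧ LenLE (N.subtype ⁻¹' T) n h)
      ⟨1, rfl, LenLE.one _ _⟩ ?_ ?_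
    · rintro n _ x ⟨h, rfl, hh⟩ (hx | hx)
      · exact ⟨h * ⟨x, hT hx⟩, rfl, hh.mul (LenLE.of_mem hx)⟩
      · have hmem : (⟨x⁻¹, hT hx⟩ : N) ∈ N.subtype ⁻¹' T := hx
        exact ⟨h * (⟨x⁻¹, hT hx⟩ : N)⁻¹, by simp, hh.mul (LenLE.of_mem hmem).inv⟩
    · rintro m n g hmn ⟨h, hg, hh⟩
      exact ⟨h, hg, hh.mono hmn⟩
  obtain ⟨h, rfl, hh⟩ := this
  exact hh

/-- A normal subgroup of index `m` in a normal subgroup of index `s` contains a subgroup which is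
normal in the whole group and has index at most `(m * s) ^ s`. -/
theorem index_normalCore_le {G : Type*} [Group G] (N : Subgroup G) [N.Normal] [N.FiniteIndex]
    (M : Subgroup N) [M.Normal] (hM : M.index ≠ 0) :
    (M.map N.subtype).normalCore.index ≠ 0 ∧
      (M.map N.subtype).normalCore.index ≤ (M.index * N.index) ^ N.index := by
  classical
  set M' := M.map N.subtype with hM'
  have hidx : M'.index = M.index * N.index := Subgroup.index_map_subtype M
  have hM'0 : M'.index ≠ 0 := by
    rw [hidx]; exact mul_ne_zero hM Subgroup.FiniteIndex.index_ne_zero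
  have hconjN : ∀ n ∈ N, ∀ x ∈ M', n * x * n⁻¹ ∈ M' := by
    rintro n hn _ ⟨x, hx, rfl⟩
    exact ⟨⟨n, hn⟩ * x * ⟨n, hn⟩⁻¹, Subgroup.Normal.conj_mem inferInstance x hx _, rfl⟩
  -- N normalizes M', so its conjugates depend only on the coset modulo N; there are at most
  -- `N.index` of them, each of the same index.
  let f : G ⧸ N → Subgroup G := fun c =>
    M'.map (MulAut.conj (Quotient.out c : G)).toMonoidHom
  have hf : ∀ c, (f c).index = M'.index := fun c => Subgroup.index_map_equiv M' (MulAut.conj _)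
  have hle : (⨅ c, f c) ≤ M'.normalCore := by
    intro x hx b
    set c : G ⧸ N := ((b⁻¹ : G) : G ⧸ N)
    have hbc : b * (Quotient.out c : G) ∈ N := by
      have := QuotientGroup.eq.1 (QuotientGroup.out_eq' c).symm
      simpa using this
    obtain ⟨y, hy, hyx⟩ := (Subgroup.mem_iInf.1 hx) c
    have := hconjN _ hbc y hy
    have e : b * x * b⁻¹ = b * (Quotient.out c : G) * y * (b * (Quotient.out c : G))⁻¹ := by
      rw [← hyx]; simp [MulAut.conj_apply, mul_assoc]
    rw [e]; exact this
  have hfin : (⨅ c, f c).index ≠ 0 := Subgroup.index_iInf_ne_zero fun c => by rw [hf]; exact hM'0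
  have hdvd := Subgroup.index_dvd_of_le hle
  have : Fintype (G ⧸ N) := Fintype.ofFinite _
  refine ⟨fun h => hfin (by rw [h] at hdvd; exact zero_dvd_iff.1 hdvd), ?_⟩
  refine (Nat.le_of_dvd (Nat.pos_of_ne_zero hfin) hdvd).trans ((Subgroup.index_iInf_le f).trans ?_)
  simp only [hf, hidx, Finset.prod_const, Finset.card_univ]
  rw [Subgroup.index_eq_card N, Nat.card_eq_fintype_card]

/-- Elements outside N are detected by G ⧸ N. Inside N, lengths grow by at most 2, and passing to
the core raises the index only to the fixed power s, which multiplies the degree by s. -/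
theorem PolylogRF.of_finiteIndex {G : Type*} [Group G] (N : Subgroup G) [N.Normal]
    [N.FiniteIndex] (hN : PolylogRF N) : PolylogRF G := by
  intro S hS
  obtain ⟨T, hT, hTN, hlen⟩ := exists_len_le_of_finiteIndex N S hS
  obtain ⟨C, k, h⟩ := hN (N.subtype ⁻¹' T) (hT.preimage N.subtype_injective.injOn)
  set s := N.index with hs
  refine ⟨s + (C * 3 ^ k * s) ^ s, k * s, fun n g hg hn => ?_⟩
  have hx1 : 1 ≤ (Nat.log 2 (n + 1) + 1) ^ (k * s) := Nat.one_le_pow _ _ (by omega)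
  by_cases hgN : g ∈ N
  · obtain ⟨M, hM, hgM, hM0, hMi⟩ := h (n + 2) ⟨g, hgN⟩ (fun h => hg (congrArg Subtype.val h))
      ((hlen n g hgN hn).subtype hTN hgN)
    obtain ⟨h1, h2⟩ := index_normalCore_le N M hM0
    refine ⟨(M.map N.subtype).normalCore, inferInstance, fun hgc => hgM ?_, h1, h2.trans ?_⟩
    · obtain ⟨y, hy, hyg⟩ := Subgroup.normalCore_le _ hgc
      have : y = ⟨g, hgN⟩ := Subtype.ext hyg
      rwa [← this]
    · have hl : Nat.log 2 (n + 2 + 1) + 1 ≤ 3 * (Nat.log 2 (n + 1) + 1) := by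
        have : Nat.log 2 (n + 2 + 1) ≤ Nat.log 2 ((n + 1) * 2 * 2) := Nat.log_mono_right (by omega)
        rw [Nat.log_mul_base (by norm_num) (by omega),
          Nat.log_mul_base (by norm_num) (by omega)] at this
        omega
      calc (M.index * s) ^ s ≤ (C * (3 * (Nat.log 2 (n + 1) + 1)) ^ k * s) ^ s := by
            gcongr
            exact hMi.trans (by gcongr)
        _ = (C * 3 ^ k * s) ^ s * (Nat.log 2 (n + 1) + 1) ^ (k * s) := by
            generalize Nat.log 2 (n + 1) + 1 = y
            rw [mul_pow 3, pow_mul y, ← mul_pow]; ring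
        _ ≤ _ := Nat.mul_le_mul_right _ (by omega)
  · refine ⟨N, inferInstance, hgN, Subgroup.FiniteIndex.index_ne_zero, ?_⟩
    calc N.index ≤ s + (C * 3 ^ k * s) ^ s := by omega
      _ ≤ _ := Nat.le_mul_of_pos_right _ hx1

theorem Group.IsVirtuallyNilpotent.polylogRF {G : Type*} [Group G] [Group.FG G]
    (hG : Group.IsVirtuallyNilpotent G) : PolylogRF G := by
  obtain ⟨N, hN, hfin⟩ := hG
  have : Group.IsNilpotent N.normalCore := by
    have : Group.IsNilpotent (N.normalCore.subgroupOf N) := inferInstance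
    exact Group.nilpotent_of_mulEquiv (Subgroup.subgroupOfEquivOfLe (Subgroup.normalCore_le N))
  obtain ⟨h, hh⟩ := Group.IsNilpotent.exists_centralCyclicSeries N.normalCore
  exact PolylogRF.of_finiteIndex N.normalCore hh.polylogRF

/-! ### From word lengths to the growth function -/

theorem wordNorm_le_iff {G : Type*} [Group G] {X : Set G} (hgen : Subgroup.closure X = ⊤) (n : ℕ)
    (g : G) : wordNorm X g ≤ n ↔ LenLE X n g := by
  constructor
  · intro h
    have hne : {n : ℕ | ∃ l : List G, l.length = n ∧ (∀ x ∈ l, x ∈ X ∨ x⁻¹ ∈ X) ∧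
        l.prod = g}.Nonempty := by
      obtain ⟨m, l, _, hl, hg⟩ := LenLE.exists_of_mem_closure (S := X) (g := g)
        (hgen ▸ Subgroup.mem_top g)
      exact ⟨l.length, l, rfl, hl, hg⟩
    obtain ⟨l, hl, hlX, hg⟩ := Nat.sInf_mem hne
    exact ⟨l, hl.le.trans h, hlX, hg⟩
  · rintro ⟨l, hl, hlX, hg⟩
    refine le_trans (Nat.sInf_le ?_) hl
    exact ⟨l, rfl, hlX, hg⟩

theorem PolylogRF.atMostPolynomialInLog {G : Type*} [Group G] (hG : PolylogRF G) (X : Set G)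
    (hX : X.Finite) (hgen : Subgroup.closure X = ⊤) :
    AtMostPolynomialInLog (normalRFGrowth X) := by
  obtain ⟨C, k, h⟩ := hG X hX
  -- The 8 gives 4 * (n + 1) ≤ 8 * n, so that log₂(n + 1) + 1 ≤ 2 * log(M * n); the 2 ^ k absorbs
  -- this factor 2.
  refine ⟨k, C * 2 ^ k + 8, by omega, fun n hn => ?_⟩
  have hbound : normalRFGrowth X n ≤ ((C * (Nat.log 2 (n + 1) + 1) ^ k : ℕ) : ℕ∞) := by
    refine iSup_le fun g => iSup_le fun hg => iSup_le fun hgn => ?_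
    obtain ⟨M, hM, hgM, hM0, hMi⟩ := h n g hg ((wordNorm_le_iff hgen n g).1 hgn)
    have hfin : Finite (G ⧸ M) := Subgroup.index_ne_zero_iff_finite.1 hM0
    refine (iInf_le_of_le M <| iInf_le_of_le hM <| iInf_le_of_le hfin <| iInf_le _ hgM).trans ?_
    exact_mod_cast hMi
  have hlog : ((Nat.log 2 (n + 1) + 1 : ℕ) : ℝ) ≤
      2 * Real.log (((C * 2 ^ k + 8 : ℕ) * n : ℕ) : ℝ) := by
    have h1 : (2 : ℝ) ^ (Nat.log 2 (n + 1)) ≤ n + 1 := by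
      exact_mod_cast Nat.pow_log_le_self 2 (by omega : n + 1 ≠ 0)
    have h2 : (Nat.log 2 (n + 1) : ℝ) * Real.log 2 ≤ Real.log (n + 1) := by
      rw [← Real.log_pow]
      exact Real.log_le_log (by positivity) h1
    have hn' : (1 : ℝ) ≤ n := by exact_mod_cast hn
    have h3 : Real.log (n + 1) + Real.log 4 ≤ Real.log (((C * 2 ^ k + 8 : ℕ) * n : ℕ) : ℝ) := by
      rw [← Real.log_mul (by positivity) (by norm_num)]
      apply Real.log_le_log (by positivity)
      push_cast
      have : (0 : ℝ) ≤ C * 2 ^ k * n := by positivity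
      nlinarith
    have h4 : Real.log 4 = 2 * Real.log 2 := by
      rw [show (4 : ℝ) = 2 ^ 2 by norm_num, Real.log_pow]; norm_num
    have h5 := Real.log_two_gt_d9
    push_cast at h3 ⊢
    nlinarith [Nat.cast_nonneg (α := ℝ) (Nat.log 2 (n + 1))]
  have hreal : ((C * (Nat.log 2 (n + 1) + 1) ^ k : ℕ) : ℝ) ≤ ((C * 2 ^ k + 8 : ℕ) : ℝ) *
      Real.log (((C * 2 ^ k + 8 : ℕ) * n : ℕ) : ℝ) ^ k := by
    rw [Nat.cast_mul, Nat.cast_pow]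
    have hl0 : 0 ≤ Real.log (((C * 2 ^ k + 8 : ℕ) * n : ℕ) : ℝ) := Real.log_natCast_nonneg _
    calc (C : ℝ) * ((Nat.log 2 (n + 1) + 1 : ℕ) : ℝ) ^ k
        ≤ C * (2 * Real.log (((C * 2 ^ k + 8 : ℕ) * n : ℕ) : ℝ)) ^ k := by gcongr
      _ = (C * 2 ^ k) * Real.log (((C * 2 ^ k + 8 : ℕ) * n : ℕ) : ℝ) ^ k := by
          rw [mul_pow]; ring
      _ ≤ _ := by
          apply mul_le_mul_of_nonneg_right _ (by positivity)
          push_cast; linarith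
  calc ((normalRFGrowth X n : ℕ∞) : ℝ≥0∞)
      ≤ (((C * (Nat.log 2 (n + 1) + 1) ^ k : ℕ) : ℕ∞) : ℝ≥0∞) := by exact_mod_cast hbound
    _ = ENNReal.ofReal ((C * (Nat.log 2 (n + 1) + 1) ^ k : ℕ) : ℝ) := by
        rw [ENNReal.ofReal_natCast]; rfl
    _ ≤ _ := ENNReal.ofReal_le_ofReal (by exact_mod_cast hreal)

/-! ### Counting solvable quotients of bounded order -/

theorem Subgroup.exists_zpow_mul_of_mem_sup {G : Type*} [Group G] {H : Subgroup G} {t : G}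
    (ht : t ∈ Subgroup.normalizer (H : Set G)) {x : G} (hx : x ∈ H ⊔ Subgroup.zpowers t) :
    ∃ (n : ℤ) (h : G), h ∈ H ∧ x = t ^ n * h := by
  have hconj : ∀ n : ℤ, ∀ h ∈ H, t ^ n * h * (t ^ n)⁻¹ ∈ H := fun n h hh =>
    (Subgroup.mem_normalizer_iff.1 (Subgroup.zpow_mem _ ht n) h).1 hh
  rw [Subgroup.zpowers_eq_closure, Subgroup.sup_eq_closure] at hx
  induction hx using Subgroup.closure_induction with
  | mem x hx =>
    rcases hx with hx | hx
    · exact ⟨0, x, hx, by simp⟩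
    · rw [← Subgroup.zpowers_eq_closure] at hx
      obtain ⟨n, rfl⟩ := Subgroup.mem_zpowers_iff.1 hx
      exact ⟨n, 1, H.one_mem, by simp⟩
  | one => exact ⟨0, 1, H.one_mem, by simp⟩
  | mul x y _ _ hx hy =>
    obtain ⟨n, h, hh, rfl⟩ := hx
    obtain ⟨m, k, hk, rfl⟩ := hy
    refine ⟨n + m, t ^ (-m) * h * (t ^ (-m))⁻¹ * k, H.mul_mem (hconj _ _ hh) hk, ?_⟩
    group
  | inv x _ hx =>
    obtain ⟨n, h, hh, rfl⟩ := hx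
    refine ⟨-n, t ^ n * h⁻¹ * (t ^ n)⁻¹, hconj _ _ (H.inv_mem hh), ?_⟩
    group

theorem Subgroup.mem_normalizer_of_conj_mem {G : Type*} [Group G] {H : Subgroup G} [Finite H]
    {t : G} (h : ∀ x ∈ H, t * x * t⁻¹ ∈ H) : t ∈ Subgroup.normalizer (H : Set G) :=
  Subgroup.mem_normalizer_fintype (S := (H : Set G)) h

/-- The element `g i ^ a i * g (i + 1) ^ a (i + 1) * ⋯` with `n` factors. -/
def normalForm {Q : Type*} [Group Q] (g : ℕ → Q) (a : ℕ → ℕ) : ℕ → ℕ → Q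
  | _, 0 => 1
  | i, n + 1 => g i ^ a i * normalForm g a (i + 1) n

/-- A subnormal series of length `L` with cyclic factors, with chosen generators. -/
structure PcChain (Q : Type*) [Group Q] (L : ℕ) where
  K : ℕ → Subgroup Q
  g : ℕ → Q
  p : ℕ → ℕ
  top : K 0 = ⊤
  bot : K L = ⊥
  mem : ∀ i, g i ∈ K i
  le : ∀ i, K (i + 1) ≤ K i
  conj : ∀ i, ∀ y ∈ K (i + 1), g i * y * (g i)⁻¹ ∈ K (i + 1)
  pow : ∀ i, g i ^ p i ∈ K (i + 1)
  rep : ∀ i, ∀ y ∈ K i, ∃ a < p i, ∃ k ∈ K (i + 1), y = g i ^ a * k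
  card : ∀ i, Nat.card (K i) = p i * Nat.card (K (i + 1))

/-- In a nontrivial solvable group a maximal subgroup containing the commutator subgroup exists and
is normal, and any element outside it generates the quotient. Its index is at least 2, so about log₂
of the order many steps reach the trivial group. -/
theorem exists_pcStep {Q : Type*} [Group Q] [Finite Q] [Group.IsSolvable Q] (K : Subgroup Q) :
    ∃ (K' : Subgroup Q) (g : Q) (p : ℕ), g ∈ K ∧ K' ≤ K ∧ (∀ y ∈ K', g * y * g⁻¹ ∈ K') ∧
      g ^ p ∈ K' ∧ (∀ y ∈ K, ∃ a < p, ∃ k ∈ K', y = g ^ a * k) ∧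
      Nat.card K = p * Nat.card K' ∧ (K' = ⊥ ∨ 2 * Nat.card K' ≤ Nat.card K) := by
  by_cases hK : K = ⊥
  · subst hK
    -- The trivial subgroup repeats with p = 1, which pads every chain to the prescribed length.
    refine ⟨⊥, 1, 1, by simp, le_rfl, by simp, by simp, fun y hy => ⟨0, by simp, y, hy, by simp⟩,
      by simp, Or.inl rfl⟩
  have : Nontrivial K := (Subgroup.nontrivial_iff_ne_bot K).2 hK
  have hlt := Group.IsSolvable.commutator_lt_top_of_nontrivial K
  obtain ⟨M, hM, hcM⟩ := (eq_top_or_exists_le_coatom (commutator K)).resolve_left hlt.ne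
  have hMn : M.Normal := Subgroup.Normal.of_commutator_le _ hcM
  obtain ⟨g, hg⟩ : ∃ g, g ∉ M := by
    by_contra! h
    exact hM.1 (eq_top_iff.2 fun x _ => h x)
  have hsup : M ⊔ Subgroup.zpowers g = ⊤ := by
    refine hM.2 _ (lt_of_le_of_ne le_sup_left fun h => hg ?_)
    rw [h]; exact Subgroup.mem_sup_right (Subgroup.mem_zpowers g)
  have hp : g ^ M.index ∈ M := M.pow_index_mem g
  have hp0 : M.index ≠ 0 := Subgroup.FiniteIndex.index_ne_zero
  refine ⟨M.map K.subtype, g, M.index, g.2, ?_, ?_, ?_, ?_, ?_, Or.inr ?_⟩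
  · exact Subgroup.map_subtype_le M
  · rintro _ ⟨y, hy, rfl⟩
    exact ⟨g * y * g⁻¹, hMn.conj_mem y hy g, rfl⟩
  · exact ⟨_, hp, rfl⟩
  · intro y hy
    obtain ⟨n, h, hh, he⟩ := Subgroup.exists_zpow_mul_of_mem_sup (H := M) (t := g)
      (by rw [Subgroup.normalizer_eq_top_iff.2 hMn]; exact Subgroup.mem_top g)
      (x := ⟨y, hy⟩) (by rw [hsup]; exact Subgroup.mem_top _)
    have hn0 : 0 ≤ n % M.index := Int.emod_nonneg _ (by exact_mod_cast hp0)
    refine ⟨(n % M.index).toNat, ?_, _,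
      ⟨(g ^ M.index) ^ (n / M.index) * h, M.mul_mem (M.zpow_mem hp _) hh, rfl⟩, ?_⟩
    · have := Int.emod_lt_of_pos n (b := M.index) (by omega)
      omega
    · have : (⟨y, hy⟩ : K) = g ^ (n % M.index).toNat * ((g ^ M.index) ^ (n / M.index) * h) := by
        rw [he, ← zpow_natCast, Int.toNat_of_nonneg hn0, ← zpow_natCast, ← zpow_mul, ← mul_assoc,
          ← zpow_add, Int.emod_add_mul_ediv]
      simpa using congrArg Subtype.val this
  · rw [Subgroup.card_subtype, mul_comm, Subgroup.card_mul_index]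
  · rw [Subgroup.card_subtype, ← Subgroup.card_mul_index M, mul_comm]
    have : 2 ≤ M.index := Subgroup.one_lt_index_of_ne_top hM.1
    exact Nat.mul_le_mul_left _ this

theorem exists_pcChain {Q : Type*} [Group Q] [Finite Q] [Group.IsSolvable Q] {L : ℕ}
    (hL : Nat.card Q < 2 ^ L) : Nonempty (PcChain Q L) := by
  choose next g p hg hle hconj hpow hrep hcard hsmall using exists_pcStep (Q := Q)
  let K : ℕ → Subgroup Q := fun i => next^[i] ⊤
  have hK : ∀ i, K (i + 1) = next (K i) := fun i => Function.iterate_succ_apply' next i ⊤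
  have hdesc : ∀ i, K i = ⊥ ∨ 2 ^ i * Nat.card (K i) ≤ Nat.card Q := by
    intro i
    induction i with
    | zero => right; simp [K]
    | succ i ih =>
      rw [hK]
      rcases hsmall (K i) with h | h
      · exact Or.inl h
      · rcases ih with h' | h'
        · left
          exact le_bot_iff.1 ((hle (K i)).trans h'.le)
        · right
          refine le_trans ?_ h'
          rw [pow_succ, mul_assoc]
          exact Nat.mul_le_mul_left _ h
  refine ⟨⟨K, fun i => g (K i), fun i => p (K i), rfl, ?_, fun i => hg _, fun i => ?_, fun i => ?_,
    fun i => ?_, fun i => ?_, fun i => ?_⟩⟩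
  · rcases hdesc L with h | h
    · exact h
    · have : 0 < Nat.card (K L) := Nat.card_pos
      nlinarith
  all_goals rw [hK]
  · exact hle _
  · exact hconj _
  · exact hpow _
  · exact hrep _
  · exact hcard _

/-- Extend a finite sequence of exponents by zero. -/
def extendExp {L m : ℕ} (a : Fin L → Fin (m + 1)) (j : ℕ) : ℕ :=
  if h : j < L then a ⟨j, h⟩ else 0

theorem normalForm_congr {Q : Type*} [Group Q] (g : ℕ → Q) {a b : ℕ → ℕ} (n : ℕ) :
    ∀ i, (∀ j, i ≤ j → j < i + n → a j = b j) → normalForm g a i n = normalForm g b i n := by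
  induction n with
  | zero => intro i _; rfl
  | succ n ih =>
    intro i h
    simp only [normalForm]
    rw [h i le_rfl (by omega), ih (i + 1) fun j h1 h2 => h j (by omega) (by omega)]

theorem normalForm_prod {Q Q' : Type*} [Group Q] [Group Q'] (g : ℕ → Q) (g' : ℕ → Q') (a : ℕ → ℕ)
    (n : ℕ) : ∀ i, normalForm (fun j => (g j, g' j)) a i n =
      (normalForm g a i n, normalForm g' a i n) := by
  induction n with
  | zero => intro i; rfl
  | succ n ih => intro i; simp only [normalForm, ih]; rfl

theorem normalForm_mem {Q : Type*} [Group Q] (g : ℕ → Q) (a : ℕ → ℕ) (D : Subgroup Q) (n : ℕ) :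
    ∀ i, (∀ j, i ≤ j → j < i + n → g j ∈ D) → normalForm g a i n ∈ D := by
  induction n with
  | zero => intro i _; exact D.one_mem
  | succ n ih =>
    intro i h
    exact D.mul_mem (D.pow_mem (h i le_rfl (by omega)) _)
      (ih (i + 1) fun j h1 h2 => h j (by omega) (by omega))

namespace PcChain

variable {Q : Type*} [Group Q] [Finite Q] {L : ℕ} (c : PcChain Q L)

theorem p_le (i : ℕ) : c.p i ≤ Nat.card Q := by
  have h1 : 0 < Nat.card (c.K (i + 1)) := Nat.card_pos
  calc c.p i ≤ c.p i * Nat.card (c.K (i + 1)) := Nat.le_mul_of_pos_right _ h1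
    _ = Nat.card (c.K i) := (c.card i).symm
    _ ≤ _ := Subgroup.card_le_card_group _

theorem p_pos (i : ℕ) : 0 < c.p i := by
  have h1 : 0 < Nat.card (c.K i) := Nat.card_pos
  rw [c.card] at h1
  exact Nat.pos_of_mul_pos_right h1

theorem exists_normalForm {m : ℕ} (hm : Nat.card Q ≤ m) (n : ℕ) :
    ∀ i, i + n = L → ∀ y ∈ c.K i,
      ∃ a : Fin L → Fin (m + 1), y = normalForm c.g (extendExp a) i n := by
  induction n with
  | zero =>
    intro i hi y hy
    obtain rfl : i = L := hi
    rw [c.bot, Subgroup.mem_bot] at hy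
    exact ⟨0, hy⟩
  | succ n ih =>
    intro i hi y hy
    obtain ⟨e, he, k, hk, rfl⟩ := c.rep i y hy
    obtain ⟨a, rfl⟩ := ih (i + 1) (by omega) k hk
    have hiL : i < L := by omega
    refine ⟨Function.update a ⟨i, hiL⟩ ⟨e, ?_⟩, ?_⟩
    · have := c.p_le i; omega
    · simp only [normalForm]
      congr 1
      · simp [extendExp, hiL]
      · apply normalForm_congr
        intro j h1 h2
        simp only [extendExp]
        split_ifs with h
        · rw [Function.update_of_ne]
          intro h'
          have := congrArg Fin.val h'
          simp at this; omega
        · rfl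

end PcChain

/-- Codes for finite solvable groups with generators indexed by `ι`. -/
abbrev PcCode (ι : Type*) (L m : ℕ) : Type _ :=
  (Fin L → Fin (m + 1)) × (Fin L → Fin L → Fin L → Fin (m + 1)) × (Fin L → Fin L → Fin (m + 1)) ×
    (ι → Fin L → Fin (m + 1))

/-- The code describes the multiplication of `Q` with respect to the series `c`. -/
structure PcChain.Realizes {Q : Type*} [Group Q] {L m : ℕ} {ι : Type*} (c : PcChain Q L)
    (x : ι → Q) (code : PcCode ι L m) : Prop where
  order : ∀ i : Fin L, c.p i = code.1 i
  conj : ∀ i j : Fin L, i < j → c.g i * c.g j * (c.g i)⁻¹ =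
    normalForm c.g (extendExp (code.2.1 i j)) (i + 1) (L - (i + 1))
  pow : ∀ i : Fin L, c.g i ^ c.p i =
    normalForm c.g (extendExp (code.2.2.1 i)) (i + 1) (L - (i + 1))
  gen : ∀ k, x k = normalForm c.g (extendExp (code.2.2.2 k)) 0 L

theorem PcChain.exists_realizes {Q : Type*} [Group Q] [Finite Q] {L m : ℕ} {ι : Type*}
    (c : PcChain Q L) (x : ι → Q) (hm : Nat.card Q ≤ m) :
    ∃ code : PcCode ι L m, c.Realizes x code := by
  have hanti : Antitone c.K := antitone_nat_of_succ_le c.le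
  have h1 : ∀ i j : Fin L, ∃ a : Fin L → Fin (m + 1), i < j → c.g i * c.g j * (c.g i)⁻¹ =
      normalForm c.g (extendExp a) (i + 1) (L - (i + 1)) := by
    intro i j
    by_cases hij : i < j
    · obtain ⟨a, ha⟩ := c.exists_normalForm hm (L - (i + 1)) (i + 1) (by omega)
        (c.g i * c.g j * (c.g i)⁻¹) (c.conj i _ (hanti (by omega) (c.mem j)))
      exact ⟨a, fun _ => ha⟩
    · exact ⟨0, fun h => absurd h hij⟩
  have h2 : ∀ i : Fin L, ∃ a : Fin L → Fin (m + 1), c.g i ^ c.p i =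
      normalForm c.g (extendExp a) (i + 1) (L - (i + 1)) := fun i =>
    c.exists_normalForm hm (L - (i + 1)) (i + 1) (by omega) _ (c.pow i)
  have h3 : ∀ k, ∃ a : Fin L → Fin (m + 1), x k = normalForm c.g (extendExp a) 0 L := fun k =>
    c.exists_normalForm hm L 0 (by omega) _ (by rw [c.top]; exact Subgroup.mem_top _)
  choose a₁ h₁ using h1
  choose a₂ h₂ using h2
  choose a₃ h₃ using h3
  exact ⟨⟨fun i => ⟨c.p i, by have := c.p_le i; omega⟩, a₁, a₂, a₃⟩, fun i => rfl, h₁, h₂, h₃⟩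

theorem card_sup_zpowers_le {E : Type*} [Group E] [Finite E] (D : Subgroup E) (d : E) (p : ℕ)
    (hp : 0 < p) (hconj : ∀ y ∈ D, d * y * d⁻¹ ∈ D) (hpow : d ^ p ∈ D) :
    Nat.card (D ⊔ Subgroup.zpowers d : Subgroup E) ≤ p * Nat.card D := by
  have hnorm := Subgroup.mem_normalizer_of_conj_mem hconj
  have hsurj : Function.Surjective (fun q : Fin p × D =>
      (⟨d ^ (q.1 : ℕ) * q.2, Subgroup.mul_mem _ (Subgroup.pow_mem _ (Subgroup.mem_sup_right
        (Subgroup.mem_zpowers d)) _) (Subgroup.mem_sup_left q.2.2)⟩ :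
        (D ⊔ Subgroup.zpowers d : Subgroup E))) := by
    rintro ⟨x, hx⟩
    obtain ⟨n, h, hh, rfl⟩ := Subgroup.exists_zpow_mul_of_mem_sup hnorm hx
    have hn0 : 0 ≤ n % p := Int.emod_nonneg _ (by omega)
    have hnp := Int.emod_lt_of_pos n (b := p) (by omega)
    refine ⟨⟨⟨(n % p).toNat, by omega⟩, ⟨(d ^ p) ^ (n / p) * h,
      D.mul_mem (D.zpow_mem hpow _) hh⟩⟩, ?_⟩
    apply Subtype.ext
    show d ^ (n % p).toNat * ((d ^ p) ^ (n / p) * h) = d ^ n * h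
    rw [← zpow_natCast, Int.toNat_of_nonneg hn0, ← zpow_natCast, ← zpow_mul, ← mul_assoc,
      ← zpow_add, Int.emod_add_mul_ediv]
  have := Nat.card_le_card_of_surjective _ hsurj
  rwa [Nat.card_prod, Nat.card_fin] at this

/-- Two quotients with the same code are isomorphic as marked groups. -/
theorem PcChain.Realizes.eq_one_of_eq_one {Q Q' : Type*} [Group Q] [Group Q'] [Finite Q]
    [Finite Q'] {L m : ℕ} {ι : Type*} {x : ι → Q} {x' : ι → Q'} {code : PcCode ι L m}
    {c : PcChain Q L} {c' : PcChain Q' L} (h : c.Realizes x code) (h' : c'.Realizes x' code)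
    (hx : Subgroup.closure (Set.range x) = ⊤) (z : Q × Q')
    (hz : z ∈ Subgroup.closure (Set.range fun k => (x k, x' k))) (hz1 : z.1 = 1) : z.2 = 1 := by
  -- The pairs d j satisfy the relations of the common code in both coordinates, so the groups D i
  -- they generate are no larger than the K i. The subgroup generated by the pairs (x k, x' k) lies
  -- in D 0 and maps onto Q; by order this map is injective.
  let d : ℕ → Q × Q' := fun j => (c.g j, c'.g j)
  let D : ℕ → Subgroup (Q × Q') := fun i => Subgroup.closure {y | ∃ j, i ≤ j ∧ j < L ∧ d j = y}
  have hdD : ∀ i j, i ≤ j → j < L → d j ∈ D i := fun i j h1 h2 =>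
    Subgroup.subset_closure ⟨j, h1, h2, rfl⟩
  have hp : ∀ i : Fin L, c.p i = c'.p i := fun i => (h.order i).trans (h'.order i).symm
  have hcard : ∀ n i, i + n = L → Nat.card (D i) ≤ Nat.card (c.K i) := by
    intro n
    induction n with
    | zero =>
      intro i hi
      have : D i = ⊥ := by
        rw [Subgroup.closure_eq_bot_iff]
        rintro y ⟨j, h1, h2, _⟩
        omega
      rw [this, Subgroup.card_bot]
      exact Nat.card_pos
    | succ n ih =>
      intro i hi
      have hiL : i < L := by omega
      have hle : D i ≤ D (i + 1) ⊔ Subgroup.zpowers (d i) := by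
        rw [Subgroup.closure_le]
        rintro _ ⟨j, h1, h2, rfl⟩
        rcases eq_or_lt_of_le h1 with rfl | h1
        · exact Subgroup.mem_sup_right (Subgroup.mem_zpowers _)
        · exact Subgroup.mem_sup_left (hdD _ _ h1 h2)
      have hnf : ∀ a : ℕ → ℕ, normalForm d a (i + 1) (L - (i + 1)) ∈ D (i + 1) := fun a =>
        normalForm_mem d a _ _ _ fun j h1 h2 => hdD _ _ h1 (by omega)
      have hgen : ∀ j, i + 1 ≤ j → j < L → d i * d j * (d i)⁻¹ ∈ D (i + 1) := by
        intro j h1 h2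
        have e1 := h.conj ⟨i, hiL⟩ ⟨j, h2⟩ (by simpa using h1)
        have e2 := h'.conj ⟨i, hiL⟩ ⟨j, h2⟩ (by simpa using h1)
        have : d i * d j * (d i)⁻¹ =
            normalForm d (extendExp (code.2.1 ⟨i, hiL⟩ ⟨j, h2⟩)) (i + 1) (L - (i + 1)) := by
          rw [normalForm_prod]
          exact Prod.ext e1 e2
        rw [this]; exact hnf _
      have hconj : ∀ y ∈ D (i + 1), d i * y * (d i)⁻¹ ∈ D (i + 1) := by
        intro y hy
        have : D (i + 1) ≤ (D (i + 1)).comap (MulAut.conj (d i)).toMonoidHom := by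
          rw [Subgroup.closure_le]
          rintro _ ⟨j, h1, h2, rfl⟩
          exact hgen j h1 h2
        exact this hy
      have hpow : d i ^ c.p i ∈ D (i + 1) := by
        have e1 := h.pow ⟨i, hiL⟩
        have e2 := h'.pow ⟨i, hiL⟩
        rw [← hp ⟨i, hiL⟩] at e2
        have : d i ^ c.p i =
            normalForm d (extendExp (code.2.2.1 ⟨i, hiL⟩)) (i + 1) (L - (i + 1)) := by
          rw [normalForm_prod]
          exact Prod.ext e1 e2
        rw [this]; exact hnf _
      calc Nat.card (D i) ≤ Nat.card (D (i + 1) ⊔ Subgroup.zpowers (d i) : Subgroup (Q × Q')) :=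
            Subgroup.card_le_of_le hle
        _ ≤ c.p i * Nat.card (D (i + 1)) :=
            card_sup_zpowers_le _ _ _ (c.p_pos i) hconj hpow
        _ ≤ c.p i * Nat.card (c.K (i + 1)) := Nat.mul_le_mul_left _ (ih _ (by omega))
        _ = _ := (c.card i).symm
  set Δ := Subgroup.closure (Set.range fun k => (x k, x' k)) with hΔ
  have hΔD : Δ ≤ D 0 := by
    rw [hΔ, Subgroup.closure_le]
    rintro _ ⟨k, rfl⟩
    have : (x k, x' k) = normalForm d (extendExp (code.2.2.2 k)) 0 L := by
      rw [normalForm_prod]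
      exact Prod.ext (h.gen k) (h'.gen k)
    show (x k, x' k) ∈ D 0
    rw [this]
    exact normalForm_mem _ _ _ _ _ fun j h1 h2 => hdD _ _ h1 (by omega)
  have hΔcard : Nat.card Δ ≤ Nat.card Q :=
    (Subgroup.card_le_of_le hΔD).trans ((hcard L 0 (by omega)).trans
      (Subgroup.card_le_card_group _))
  let φ : Δ →* Q := (MonoidHom.fst Q Q').comp Δ.subtype
  have hφ : Function.Surjective φ := by
    rw [← MonoidHom.range_eq_top, eq_top_iff, ← hx, Subgroup.closure_le]
    rintro _ ⟨k, rfl⟩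
    exact ⟨⟨(x k, x' k), Subgroup.subset_closure ⟨k, rfl⟩⟩, rfl⟩
  have hinj := (hφ.bijective_of_nat_card_le hΔcard).1
  have : (⟨z, hz⟩ : Δ) = 1 := hinj (by rw [map_one]; exact hz1)
  have := congrArg Subtype.val this
  simp only [Subgroup.coe_one] at this
  rw [this]; rfl

/-- The number of normal subgroups of index at most `m` in a finitely generated solvable group is
quasi-polynomial in `m`. -/
theorem card_normal_index_le {G : Type*} [Group G] [Group.IsSolvable G] {ι : Type*} [Finite ι]
    (x : ι → G) (hx : Subgroup.closure (Set.range x) = ⊤) (m L : ℕ) (hL : m < 2 ^ L) :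
    {N : Subgroup G | N.Normal ∧ N.index ≠ 0 ∧ N.index ≤ m}.Finite ∧
      Nat.card {N : Subgroup G | N.Normal ∧ N.index ≠ 0 ∧ N.index ≤ m} ≤
        (m + 1) ^ (L + L * (L * L) + L * L + Nat.card ι * L) := by
  set 𝒩 := {N : Subgroup G | N.Normal ∧ N.index ≠ 0 ∧ N.index ≤ m}
  have hex : ∀ N : 𝒩, ∃ code : PcCode ι L m, ∃ (_ : (N : Subgroup G).Normal)
      (c : PcChain (G ⧸ (N : Subgroup G)) L),
      c.Realizes (fun k => (x k : G ⧸ (N : Subgroup G))) code := by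
    rintro ⟨N, hN, h0, hm⟩
    have : Finite (G ⧸ N) := Subgroup.index_ne_zero_iff_finite.1 h0
    have hs : Group.IsSolvable (G ⧸ N) :=
      Group.isSolvable_of_surjective (QuotientGroup.mk'_surjective N)
    obtain ⟨c⟩ := exists_pcChain (Q := G ⧸ N) (L := L) (lt_of_le_of_lt hm hL)
    obtain ⟨code, hc⟩ := c.exists_realizes (fun k => (x k : G ⧸ N)) (m := m) hm
    exact ⟨code, hN, c, hc⟩
  choose F hF using hex
  -- With equal codes, the image of G in G ⧸ N × G ⧸ N' projects injectively to the first factor, so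
  -- an element dying in G ⧸ N also dies in G ⧸ N'.
  have hle : ∀ N N' : 𝒩, F N = F N' → (N : Subgroup G) ≤ N' := by
    rintro ⟨N, hN, h0, hm⟩ ⟨N', hN', h0', hm'⟩ he n hn
    obtain ⟨_, c, hc⟩ := hF ⟨N, hN, h0, hm⟩
    obtain ⟨_, c', hc'⟩ := hF ⟨N', hN', h0', hm'⟩
    rw [← he] at hc'
    have : Finite (G ⧸ N) := Subgroup.index_ne_zero_iff_finite.1 h0
    have : Finite (G ⧸ N') := Subgroup.index_ne_zero_iff_finite.1 h0'
    let φ : G →* (G ⧸ N) × (G ⧸ N') := (QuotientGroup.mk' N).prod (QuotientGroup.mk' N')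
    have hgen : Subgroup.closure (Set.range fun k => (x k : G ⧸ N)) = ⊤ := by
      have := MonoidHom.map_closure (QuotientGroup.mk' N) (Set.range x)
      rw [hx, Subgroup.map_top_of_surjective _ (QuotientGroup.mk'_surjective N),
        ← Set.range_comp] at this
      exact this.symm
    have hz : φ n ∈ Subgroup.closure
        (Set.range fun k => ((x k : G ⧸ N), (x k : G ⧸ N'))) := by
      have := MonoidHom.map_closure φ (Set.range x)
      rw [hx, ← Set.range_comp] at this
      have h2 : φ n ∈ (⊤ : Subgroup G).map φ := ⟨n, Subgroup.mem_top n, rfl⟩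
      rw [this] at h2
      exact h2
    have := hc.eq_one_of_eq_one hc' hgen (φ n) hz ((QuotientGroup.eq_one_iff n).2 hn)
    exact (QuotientGroup.eq_one_iff n).1 this
  have hinj : Function.Injective F := fun N N' h =>
    Subtype.ext (le_antisymm (hle _ _ h) (hle _ _ h.symm))
  have hfin : Finite 𝒩 := Finite.of_injective F hinj
  refine ⟨hfin, (Nat.card_le_card_of_injective F hinj).trans (le_of_eq ?_)⟩
  simp only [PcCode, Nat.card_prod, Nat.card_fun, Nat.card_fin]
  ring

/-! ### Positive relations -/

/-- The positive word in `a * b` and `b` given by a list of bits. -/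
def posWord {G : Type*} [Group G] (a b : G) : List Bool → G
  | [] => 1
  | true :: l => a * b * posWord a b l
  | false :: l => b * posWord a b l

/-- No pair `a * b`, `b` freely generates a semigroup (by words of equal length). -/
def PositiveRelations (G : Type*) [Group G] : Prop :=
  ∀ a b : G, ∃ l₁ l₂ : List Bool, l₁.length = l₂.length ∧
    a * b * posWord a b l₁ = b * posWord a b l₂

/-- Cancelling the longest common prefix leaves two words with different first letters. -/
theorem exists_relation_of_posWord_eq {G : Type*} [Group G] (a b : G) (l₁ : List Bool) :
    ∀ l₂ : List Bool, l₁.length = l₂.length → l₁ ≠ l₂ → posWord a b l₁ = posWord a b l₂ →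
      ∃ l₁ l₂ : List Bool, l₁.length = l₂.length ∧
        a * b * posWord a b l₁ = b * posWord a b l₂ := by
  induction l₁ with
  | nil =>
    intro l₂ hl hne _
    exact absurd (List.length_eq_zero_iff.1 hl.symm).symm hne
  | cons e l₁ ih =>
    intro l₂ hl hne he
    rcases l₂ with _ | ⟨f, l₂⟩
    · simp at hl
    have hl' : l₁.length = l₂.length := by simpa using hl
    cases e <;> cases f
    · exact ih l₂ hl' (fun h => hne (by rw [h])) (mul_left_cancel he)
    · exact ⟨l₂, l₁, hl'.symm, he.symm⟩
    · exact ⟨l₁, l₂, hl', he⟩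
    · exact ih l₂ hl' (fun h => hne (by rw [h])) (mul_left_cancel he)

theorem LenLE.posWord {G : Type*} [Group G] {X : Set G} {a b : G} {E : ℕ} (ha : LenLE X E a)
    (hb : LenLE X E b) (l : List Bool) : LenLE X (l.length * (E + E)) (posWord a b l) := by
  induction l with
  | nil => exact LenLE.one _ _
  | cons e l ih =>
    cases e
    · exact (hb.mul ih).mono (by rw [List.length_cons, Nat.succ_mul]; omega)
    · exact ((ha.mul hb).mul ih).mono (by rw [List.length_cons, Nat.succ_mul]; omega)

theorem exists_quotient_of_growth {G : Type*} [Group G] {X : Set G}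
    (hgen : Subgroup.closure X = ⊤) {n : ℕ} {B : ℝ} (hB : 0 ≤ B)
    (h : ((normalRFGrowth X n : ℕ∞) : ℝ≥0∞) ≤ ENNReal.ofReal B) (g : G) (hg : g ≠ 1)
    (hgn : LenLE X n g) :
    ∃ R : Subgroup G, R.Normal ∧ g ∉ R ∧ R.index ≠ 0 ∧ (R.index : ℝ) ≤ B := by
  by_contra! hcon
  have h1 : ((⌊B⌋₊ + 1 : ℕ) : ℕ∞) ≤ normalDivisibility g := by
    refine le_iInf fun R => le_iInf fun hR => le_iInf fun hfin => le_iInf fun hgR => ?_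
    have h2 := hcon R hR hgR Subgroup.index_ne_zero_of_finite
    have h3 : ⌊B⌋₊ < R.index := (Nat.floor_lt hB).2 h2
    exact_mod_cast h3
  have h2 : normalDivisibility g ≤ normalRFGrowth X n :=
    le_iSup_of_le g <| le_iSup_of_le hg <| le_iSup_of_le ((wordNorm_le_iff hgen n g).2 hgn) le_rfl
  have h3 : (((⌊B⌋₊ + 1 : ℕ) : ℕ∞) : ℝ≥0∞) ≤ ENNReal.ofReal B :=
    le_trans (by exact_mod_cast h1.trans h2) h
  have h4 : ENNReal.ofReal ((⌊B⌋₊ + 1 : ℕ) : ℝ) ≤ ENNReal.ofReal B := by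
    rw [ENNReal.ofReal_natCast]; exact h3
  rw [ENNReal.ofReal_le_ofReal_iff hB] at h4
  have := Nat.lt_floor_add_one B
  push_cast at h4
  linarith

/-- The inequality contradicts the final count in the next theorem, where L = A + k * i + 1 bounds
the logarithm of the quotient orders. -/
theorem exists_poly_lt_two_pow (r A k c : ℕ) :
    ∃ i : ℕ, (r + 4) * (A + k * i + 1) ^ 4 + c < 2 ^ i := by
  set B : ℕ := (r + 4) * (A + k + 1) ^ 4 * 16 + c with hB
  have ht := tendsto_pow_const_div_const_pow_of_one_lt 4 (by norm_num : (1 : ℝ) < 2)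
  have hev := ht.eventually (gt_mem_nhds (show (0 : ℝ) < 1 / (B + 1) by positivity))
  obtain ⟨i, hi, hi1⟩ := (hev.and (Filter.eventually_ge_atTop 1)).exists
  refine ⟨i, ?_⟩
  rw [div_lt_div_iff₀ (by positivity) (by positivity), one_mul] at hi
  have hi' : i ^ 4 * (B + 1) < 2 ^ i := by exact_mod_cast hi
  refine lt_of_le_of_lt ?_ hi'
  have h1 : A + k * i + 1 ≤ (A + k + 1) * (2 * i) := by nlinarith
  have h2 : (A + k * i + 1) ^ 4 ≤ (A + k + 1) ^ 4 * 16 * i ^ 4 := by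
    calc _ ≤ ((A + k + 1) * (2 * i)) ^ 4 := Nat.pow_le_pow_left h1 4
      _ = _ := by ring
  have h3 : 1 ≤ i ^ 4 := Nat.one_le_pow _ _ hi1
  calc (r + 4) * (A + k * i + 1) ^ 4 + c
      ≤ (r + 4) * ((A + k + 1) ^ 4 * 16 * i ^ 4) + c * i ^ 4 := by
        gcongr; exact Nat.le_mul_of_pos_right _ h3
    _ = i ^ 4 * B := by rw [hB]; ring
    _ ≤ _ := Nat.mul_le_mul_left _ (by omega)

theorem AtMostPolynomialInLog.positiveRelations {G : Type*} [Group G] [Group.IsSolvable G]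
    {X : Set G} (hX : X.Finite) (hgen : Subgroup.closure X = ⊤)
    (h : AtMostPolynomialInLog (normalRFGrowth X)) : PositiveRelations G := by
  classical
  obtain ⟨k, M, hM, h⟩ := h
  intro a b
  by_contra hcon
  obtain ⟨E, hE1, ha, hb⟩ : ∃ E, 1 ≤ E ∧ LenLE X E a ∧ LenLE X E b := by
    obtain ⟨E₁, h₁⟩ := LenLE.exists_of_mem_closure (S := X) (g := a) (hgen ▸ Subgroup.mem_top a)
    obtain ⟨E₂, h₂⟩ := LenLE.exists_of_mem_closure (S := X) (g := b) (hgen ▸ Subgroup.mem_top b)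
    exact ⟨E₁ + E₂ + 1, by omega, h₁.mono (by omega), h₂.mono (by omega)⟩
  have : Finite X := hX
  set r := Nat.card X with hr
  obtain ⟨A, hA⟩ : ∃ A, M ≤ 2 ^ A := ⟨M, Nat.lt_two_pow_self.le⟩
  obtain ⟨c, hc⟩ : ∃ c, M * (4 * E) ≤ 2 ^ c := ⟨_, Nat.lt_two_pow_self.le⟩
  -- The parameters are arranged so that M * n ≤ 2 ^ (2 ^ i), hence log(M * n) ≤ 2 ^ i and all
  -- quotients needed have order at most m < 2 ^ L. The length n = 4 * E * N allows for a quotient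
  -- of two words with N letters, each letter having length at most 2 * E.
  obtain ⟨i, hi⟩ := exists_poly_lt_two_pow r A k c
  obtain ⟨J, hJ⟩ : ∃ J, 2 ^ i = c + J := ⟨2 ^ i - c, by omega⟩
  set N := 2 ^ J with hN
  set n := N * (4 * E) with hn
  have hn1 : 1 ≤ n := Nat.mul_pos (by positivity) (by omega)
  set m := M * (2 ^ i) ^ k with hm
  set L := A + k * i + 1 with hL
  have hmL : m < 2 ^ L := by
    calc m ≤ 2 ^ A * (2 ^ i) ^ k := Nat.mul_le_mul_right _ hA
      _ = 2 ^ (A + k * i) := by rw [← pow_mul, ← pow_add, mul_comm i]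
      _ < 2 ^ L := Nat.pow_lt_pow_right (by norm_num) (by omega)
  have hlog0 : 0 ≤ Real.log ((M * n : ℕ) : ℝ) := Real.log_natCast_nonneg _
  have hlog : Real.log ((M * n : ℕ) : ℝ) ≤ 2 ^ i := by
    have h1 : M * n ≤ 2 ^ (2 ^ i) := by
      calc M * n = M * (4 * E) * N := by rw [hn]; ring
        _ ≤ 2 ^ c * 2 ^ J := Nat.mul_le_mul_right _ hc
        _ = _ := by rw [← pow_add, ← hJ]
    have h2 : Real.log ((M * n : ℕ) : ℝ) ≤ Real.log ((2 : ℝ) ^ (2 ^ i)) := by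
      apply Real.log_le_log
      · exact_mod_cast Nat.mul_pos hM hn1
      · exact_mod_cast h1
    rw [Real.log_pow] at h2
    have h3 : Real.log 2 ≤ 1 := by linarith [Real.log_two_lt_d9]
    calc _ ≤ ((2 ^ i : ℕ) : ℝ) * Real.log 2 := h2
      _ ≤ ((2 ^ i : ℕ) : ℝ) * 1 := by gcongr
      _ = 2 ^ i := by push_cast; ring
  have hquot : ∀ g : G, g ≠ 1 → LenLE X n g →
      ∃ R : Subgroup G, R.Normal ∧ g ∉ R ∧ R.index ≠ 0 ∧ R.index ≤ m := by
    intro g hg hgn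
    obtain ⟨R, hR, hgR, h0, hi⟩ := exists_quotient_of_growth hgen (by positivity) (h n hn1) g hg hgn
    refine ⟨R, hR, hgR, h0, ?_⟩
    have : (R.index : ℝ) ≤ (m : ℝ) := by
      refine hi.trans ?_
      rw [hm]; push_cast
      have hlog' : Real.log ((M : ℝ) * n) ≤ 2 ^ i := by exact_mod_cast hlog
      have hlog0' : 0 ≤ Real.log ((M : ℝ) * n) := by exact_mod_cast hlog0
      gcongr
    exact_mod_cast this
  obtain ⟨hfin, hcard⟩ := card_normal_index_le (fun x : X => (x : G))
    (by rw [Subtype.range_coe]; exact hgen) m L hmL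
  set 𝒩 := {R : Subgroup G | R.Normal ∧ R.index ≠ 0 ∧ R.index ≤ m}
  have : Finite 𝒩 := hfin
  have : Fintype 𝒩 := Fintype.ofFinite _
  have hfinq : ∀ R : 𝒩, Finite (G ⧸ (R : Subgroup G)) := fun R =>
    Subgroup.index_ne_zero_iff_finite.1 R.2.2.1
  -- All 2 ^ N words are sent to the product of all quotients of order at most m. Injectivity gives
  -- N ≤ L * (2 ^ L) ^ e, that is J ≤ (r + 4) * L ^ 4, against the choice of i.
  let Φ : (Fin N → Bool) → ∀ R : 𝒩, G ⧸ (R : Subgroup G) := fun e R =>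
    (posWord a b (List.ofFn e) : G)
  have hΦ : Function.Injective Φ := by
    intro e f hef
    by_contra hne
    have hlen : (List.ofFn e).length = (List.ofFn f).length := by simp
    have hw : posWord a b (List.ofFn e) ≠ posWord a b (List.ofFn f) := fun he =>
      hcon (exists_relation_of_posWord_eq a b _ _ hlen (fun h => hne (List.ofFn_injective h)) he)
    have hlenle : LenLE X n ((posWord a b (List.ofFn e))⁻¹ * posWord a b (List.ofFn f)) := by
      refine ((ha.posWord hb _).inv.mul (ha.posWord hb _)).mono ?_
      rw [List.length_ofFn, List.length_ofFn, hn, ← mul_add]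
      exact Nat.mul_le_mul_left _ (by omega)
    obtain ⟨R, hR, hgR, h0, hi⟩ := hquot _ (fun h => hw (inv_mul_eq_one.1 h)) hlenle
    exact hgR (QuotientGroup.eq.1 (congrFun hef ⟨R, hR, h0, hi⟩))
  have h1 := Nat.card_le_card_of_injective Φ hΦ
  rw [Nat.card_fun, Nat.card_fin, Nat.card_eq_fintype_card (α := Bool), Fintype.card_bool,
    Nat.card_pi] at h1
  set e := L + L * (L * L) + L * L + r * L with he
  have h2 : ∏ R : 𝒩, Nat.card (G ⧸ (R : Subgroup G)) ≤ 2 ^ (L * (2 ^ L) ^ e) := by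
    calc ∏ R : 𝒩, Nat.card (G ⧸ (R : Subgroup G)) ≤ ∏ R : 𝒩, 2 ^ L :=
          Finset.prod_le_prod' fun R _ => (R.2.2.2.trans hmL.le)
      _ = (2 ^ L) ^ Nat.card 𝒩 := by
          rw [Finset.prod_const, Finset.card_univ, Nat.card_eq_fintype_card]
      _ ≤ (2 ^ L) ^ (2 ^ L) ^ e := by
          apply Nat.pow_le_pow_right (by positivity)
          exact hcard.trans (Nat.pow_le_pow_left hmL e)
      _ = _ := by rw [← pow_mul]
  have h3 : N ≤ L * (2 ^ L) ^ e := (Nat.pow_le_pow_iff_right (by norm_num)).1 (h1.trans h2)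
  have h4 : N ≤ 2 ^ ((r + 4) * L ^ 4) := by
    calc N ≤ L * (2 ^ L) ^ e := h3
      _ ≤ 2 ^ L * (2 ^ L) ^ e := Nat.mul_le_mul_right _ Nat.lt_two_pow_self.le
      _ = 2 ^ (L * (e + 1)) := by rw [← pow_succ', ← pow_mul]
      _ ≤ _ := by
          apply Nat.pow_le_pow_right (by norm_num)
          have hL1 : 1 ≤ L := by omega
          have e2 : L ≤ L ^ 4 := Nat.le_self_pow (by norm_num) L
          have e3 : L ^ 2 ≤ L ^ 4 := Nat.pow_le_pow_right hL1 (by norm_num)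
          have e4 : L ^ 3 ≤ L ^ 4 := Nat.pow_le_pow_right hL1 (by norm_num)
          have e5 : r * L ^ 2 ≤ r * L ^ 4 := Nat.mul_le_mul_left _ e3
          calc L * (e + 1) = L ^ 2 + L ^ 4 + L ^ 3 + r * L ^ 2 + L := by rw [he]; ring
            _ ≤ L ^ 4 + L ^ 4 + L ^ 4 + r * L ^ 4 + L ^ 4 := by omega
            _ = _ := by ring
  have h5 : J ≤ (r + 4) * L ^ 4 := (Nat.pow_le_pow_iff_right (by norm_num)).1 h4
  omega

/-! ### Finite generation of kernels -/

theorem PositiveRelations.subgroup {G : Type*} [Group G] (h : PositiveRelations G)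
    (H : Subgroup G) : PositiveRelations H := by
  intro a b
  obtain ⟨l₁, l₂, hl, he⟩ := h a b
  have hcoe : ∀ l, ((posWord a b l : H) : G) = posWord (a : G) b l := by
    intro l
    induction l with
    | nil => rfl
    | cons e l ih => cases e <;> simp [posWord, ih]
  exact ⟨l₁, l₂, hl, Subtype.ext (by simpa [hcoe] using he)⟩

theorem map_posWord {G H : Type*} [Group G] [Group H] (f : G →* H) (a b : G) (l : List Bool) :
    f (posWord a b l) = posWord (f a) (f b) l := by
  induction l with
  | nil => exact map_one f
  | cons e l ih => cases e <;> simp [posWord, ih]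

theorem PositiveRelations.of_surjective {G H : Type*} [Group G] [Group H]
    (h : PositiveRelations G) (f : G →* H) (hf : Function.Surjective f) :
    PositiveRelations H := by
  intro a b
  obtain ⟨a, rfl⟩ := hf a
  obtain ⟨b, rfl⟩ := hf b
  obtain ⟨l₁, l₂, hl, he⟩ := h a b
  refine ⟨l₁, l₂, hl, ?_⟩
  rw [← map_posWord, ← map_posWord, ← map_mul, ← map_mul, he, map_mul]

/-- Moving every b to the right turns the occurrence of a at position i into its conjugate by b ^ i.
-/
theorem posWord_mem_closure {G : Type*} [Group G] (a b : G) (l : List Bool) :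
    posWord a b l * (b ^ l.length)⁻¹ ∈ Subgroup.closure
      ((fun i : ℤ => b ^ i * a * (b ^ i)⁻¹) '' Set.Ico 0 (l.length : ℤ)) := by
  induction l with
  | nil => simp [posWord]
  | cons e l ih =>
    have hconj : b * (posWord a b l * (b ^ l.length)⁻¹) * b⁻¹ ∈ Subgroup.closure
        ((fun i : ℤ => b ^ i * a * (b ^ i)⁻¹) '' Set.Ico 0 ((e :: l).length : ℤ)) := by
      have := Subgroup.mem_map_of_mem (MulAut.conj b).toMonoidHom ih
      rw [MonoidHom.map_closure, ← Set.image_comp] at this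
      refine Subgroup.closure_mono ?_ this
      rintro _ ⟨i, hi, rfl⟩
      refine ⟨i + 1, ⟨by have := hi.1; omega, by
        have := hi.2; rw [List.length_cons]; push_cast; omega⟩, ?_⟩
      simp only [Function.comp, MulEquiv.coe_toMonoidHom, MulAut.conj_apply]
      group
    have ha : a ∈ Subgroup.closure
        ((fun i : ℤ => b ^ i * a * (b ^ i)⁻¹) '' Set.Ico 0 ((e :: l).length : ℤ)) :=
      Subgroup.subset_closure ⟨0, ⟨le_rfl, by rw [List.length_cons]; push_cast; omega⟩, by simp⟩
    cases e
    · have e1 : posWord a b (false :: l) * (b ^ (false :: l).length)⁻¹ =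
          b * (posWord a b l * (b ^ l.length)⁻¹) * b⁻¹ := by
        simp only [posWord, List.length_cons, pow_succ', mul_inv_rev]; group
      rw [e1]; exact hconj
    · have e1 : posWord a b (true :: l) * (b ^ (true :: l).length)⁻¹ =
          a * (b * (posWord a b l * (b ^ l.length)⁻¹) * b⁻¹) := by
        simp only [posWord, List.length_cons, pow_succ', mul_inv_rev]; group
      rw [e1]; exact Subgroup.mul_mem _ ha hconj

/-- The relation says a = b * (w₂ * w₁⁻¹) * b⁻¹. Equal lengths make the trailing powers of b cancel,
and the outer conjugation shifts the exponents to start at 1. -/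
theorem PositiveRelations.exists_mem_closure {G : Type*} [Group G] (h : PositiveRelations G)
    (a b : G) : ∃ n : ℕ, a ∈ Subgroup.closure
      ((fun i : ℤ => b ^ i * a * (b ^ i)⁻¹) '' Set.Icc 1 (n : ℤ)) := by
  obtain ⟨l₁, l₂, hl, he⟩ := h a b
  refine ⟨l₁.length, ?_⟩
  have h1 := posWord_mem_closure a b l₁
  have h2 := posWord_mem_closure a b l₂
  rw [← hl] at h2
  have h3 := Subgroup.mem_map_of_mem (MulAut.conj b).toMonoidHom
    (Subgroup.mul_mem _ h2 (Subgroup.inv_mem _ h1))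
  have e : (MulAut.conj b).toMonoidHom (posWord a b l₂ * (b ^ l₁.length)⁻¹ *
      (posWord a b l₁ * (b ^ l₁.length)⁻¹)⁻¹) = a := by
    have : b * posWord a b l₂ * (posWord a b l₁)⁻¹ * b⁻¹ = a := by
      rw [← he]; group
    simp only [MulEquiv.coe_toMonoidHom, MulAut.conj_apply]
    refine Eq.trans ?_ this
    group
  rw [e, MonoidHom.map_closure, ← Set.image_comp] at h3
  refine Subgroup.closure_mono ?_ h3
  rintro _ ⟨i, hi, rfl⟩
  refine ⟨i + 1, ⟨by have := hi.1; omega, by have := hi.2; omega⟩, ?_⟩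
  simp only [Function.comp, MulEquiv.coe_toMonoidHom, MulAut.conj_apply]
  group

theorem Subgroup.mem_normalizer_of_conj_mem_conj_inv_mem {G : Type*} [Group G] {H : Subgroup G}
    {t : G} (h1 : ∀ x ∈ H, t * x * t⁻¹ ∈ H) (h2 : ∀ x ∈ H, t⁻¹ * x * t ∈ H) :
    t ∈ Subgroup.normalizer (H : Set G) := by
  rw [Subgroup.mem_normalizer_iff]
  refine fun x => ⟨h1 x, fun hx => ?_⟩
  have := h2 _ hx
  have e : t⁻¹ * (t * x * t⁻¹) * t = x := by group
  rwa [e] at this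

/-- Milnor's lemma: the conjugates of `a` under powers of `b` generate a finitely generated
subgroup. -/
theorem PositiveRelations.exists_fg_normalized {G : Type*} [Group G] (h : PositiveRelations G)
    (a b : G) (H : Subgroup G) (ha : a ∈ H) (hb : b ∈ Subgroup.normalizer (H : Set G)) :
    ∃ C : Subgroup G, C.FG ∧ a ∈ C ∧ C ≤ H ∧ b ∈ Subgroup.normalizer (C : Set G) := by
  obtain ⟨N, hN⟩ := h.exists_mem_closure a b
  obtain ⟨N', hN'⟩ := h.exists_mem_closure a b⁻¹
  let cj : ℤ → G := fun i => b ^ i * a * (b ^ i)⁻¹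
  -- The window 0, …, n is long enough for both relations: the one for b expresses the conjugate
  -- with exponent -1 through the window, the one for b⁻¹ that with exponent n + 1.
  set n : ℤ := N + N'
  set C := Subgroup.closure (cj '' Set.Icc 0 n) with hC
  have hcj : ∀ i, 0 ≤ i → i ≤ n → cj i ∈ C := fun i h1 h2 =>
    Subgroup.subset_closure ⟨i, ⟨h1, h2⟩, rfl⟩
  have hmap : ∀ (x : G) (S : Set G), a ∈ Subgroup.closure S → (∀ s ∈ S, x * s * x⁻¹ ∈ C) →
      x * a * x⁻¹ ∈ C := by
    intro x S haS hS
    have : Subgroup.closure S ≤ C.comap (MulAut.conj x).toMonoidHom := by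
      rw [Subgroup.closure_le]; exact hS
    exact this haS
  refine ⟨C, (Subgroup.fg_iff _).2 ⟨_, rfl, (Set.finite_Icc _ _).image _⟩, ?_, ?_, ?_⟩
  · simpa [cj] using hcj 0 le_rfl (by omega)
  · rw [hC, Subgroup.closure_le]
    rintro _ ⟨i, _, rfl⟩
    exact (Subgroup.mem_normalizer_iff.1 (Subgroup.zpow_mem _ hb i) a).1 ha
  · apply Subgroup.mem_normalizer_of_conj_mem_conj_inv_mem
    · intro x hx
      have : C ≤ C.comap (MulAut.conj b).toMonoidHom := by
        conv_lhs => rw [hC]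
        rw [Subgroup.closure_le]
        rintro _ ⟨i, hi, rfl⟩
        show b * cj i * b⁻¹ ∈ C
        have e : b * cj i * b⁻¹ = cj (i + 1) := by simp only [cj]; group
        rw [e]
        by_cases hin : i + 1 ≤ n
        · exact hcj _ (by have := hi.1; omega) hin
        · obtain rfl : i = n := le_antisymm hi.2 (by omega)
          refine hmap (b ^ (n + 1)) _ hN' ?_
          rintro _ ⟨j, hj, rfl⟩
          have e2 : b ^ (n + 1) * (b⁻¹ ^ j * a * (b⁻¹ ^ j)⁻¹) * (b ^ (n + 1))⁻¹ =
              cj (n + 1 - j) := by simp only [cj]; group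
          show b ^ (n + 1) * (b⁻¹ ^ j * a * (b⁻¹ ^ j)⁻¹) * (b ^ (n + 1))⁻¹ ∈ C
          rw [e2]
          exact hcj _ (by have := hj.2; omega) (by have := hj.1; omega)
      exact this hx
    · intro x hx
      have : C ≤ C.comap (MulAut.conj b⁻¹).toMonoidHom := by
        conv_lhs => rw [hC]
        rw [Subgroup.closure_le]
        rintro _ ⟨i, hi, rfl⟩
        show b⁻¹ * cj i * b⁻¹⁻¹ ∈ C
        have e : b⁻¹ * cj i * b⁻¹⁻¹ = cj (i - 1) := by simp only [cj]; group
        rw [e]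
        by_cases hin : 0 ≤ i - 1
        · exact hcj _ hin (by have := hi.2; omega)
        · obtain rfl : i = 0 := le_antisymm (by omega) hi.1
          refine hmap (b ^ (0 - 1 : ℤ)) _ hN ?_
          rintro _ ⟨j, hj, rfl⟩
          have e2 : b ^ (0 - 1 : ℤ) * (b ^ j * a * (b ^ j)⁻¹) * (b ^ (0 - 1 : ℤ))⁻¹ =
              cj (j - 1) := by simp only [cj]; group
          show b ^ (0 - 1 : ℤ) * (b ^ j * a * (b ^ j)⁻¹) * (b ^ (0 - 1 : ℤ))⁻¹ ∈ C
          rw [e2]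
          exact hcj _ (by have := hj.1; omega) (by have := hj.2; omega)
      simpa using this hx

/-- Write the generators of H as t ^ n * x with x in H₁. Milnor's lemma puts each x in a finitely
generated subgroup of H₁ normalized by t. Their join J satisfies H = J⟨t⟩, so H₁ is generated by J
and the cyclic group H₁ ⊓ ⟨t⟩. -/
theorem PositiveRelations.fg_of_cyclic {G : Type*} [Group G] (h : PositiveRelations G)
    {H H₁ : Subgroup G} {t : G} (hH : H = H₁ ⊔ Subgroup.zpowers t)
    (ht : t ∈ Subgroup.normalizer (H₁ : Set G)) (hfg : H.FG) : H₁.FG := by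
  obtain ⟨S, hS⟩ := hfg
  have hdec : ∀ s ∈ S, ∃ (n : ℤ) (x : G), x ∈ H₁ ∧ s = t ^ n * x := fun s hs =>
    Subgroup.exists_zpow_mul_of_mem_sup ht (hH ▸ hS ▸ Subgroup.subset_closure hs)
  choose! n x hx hsx using hdec
  have hC : ∀ s ∈ S, ∃ C : Subgroup G, C.FG ∧ x s ∈ C ∧ C ≤ H₁ ∧
      t ∈ Subgroup.normalizer (C : Set G) := fun s hs =>
    h.exists_fg_normalized (x s) t H₁ (hx s hs) ht
  choose! C hCfg hxC hCH hCt using hC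
  set J := ⨆ s ∈ S, C s with hJ
  have hJfg : J.FG := Subgroup.FG.biSup_finset S C hCfg
  have hCJ : ∀ s ∈ S, C s ≤ J := fun s hs => le_iSup₂_of_le s hs le_rfl
  have hJH : J ≤ H₁ := iSup₂_le hCH
  have hJt : t ∈ Subgroup.normalizer (J : Set G) := by
    apply Subgroup.mem_normalizer_of_conj_mem_conj_inv_mem
    · intro y hy
      have : J ≤ J.comap (MulAut.conj t).toMonoidHom := iSup₂_le fun s hs z hz =>
        hCJ s hs ((Subgroup.mem_normalizer_iff.1 (hCt s hs) z).1 hz)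
      exact this hy
    · intro y hy
      have : J ≤ J.comap (MulAut.conj t⁻¹).toMonoidHom := iSup₂_le fun s hs z hz =>
        hCJ s hs ((Subgroup.mem_normalizer_iff.1 (Subgroup.inv_mem _ (hCt s hs)) z).1 hz)
      simpa using this hy
  have hle : H ≤ J ⊔ Subgroup.zpowers t := by
    rw [← hS, Subgroup.closure_le]
    intro s hs
    rw [hsx s hs]
    exact Subgroup.mul_mem _ (Subgroup.mem_sup_right (Subgroup.zpow_mem_zpowers t _))
      (Subgroup.mem_sup_left (hCJ s hs (hxC s hs)))
  have hH₁ : H₁ = J ⊔ (H₁ ⊓ Subgroup.zpowers t) := by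
    refine le_antisymm ?_ (sup_le hJH inf_le_left)
    intro y hy
    obtain ⟨m, j, hj, rfl⟩ := Subgroup.exists_zpow_mul_of_mem_sup hJt
      (hle (hH ▸ Subgroup.mem_sup_left hy))
    have : t ^ m ∈ H₁ := by
      have := H₁.mul_mem hy (H₁.inv_mem (hJH hj))
      rwa [mul_inv_cancel_right] at this
    exact Subgroup.mul_mem _ (Subgroup.mem_sup_right ⟨this, Subgroup.zpow_mem_zpowers t m⟩)
      (Subgroup.mem_sup_left hj)
  rw [hH₁]
  exact hJfg.sup (Subgroup.fg_of_le_zpowers t _ inf_le_right)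

/-- A finitely generated virtually nilpotent normal subgroup contains a nilpotent subgroup of
finite index which is normal in the whole group. -/
theorem exists_normal_nilpotent_of_isVirtuallyNilpotent {G : Type*} [Group G] (K : Subgroup G)
    [K.Normal] [Group.FG K] (hK : Group.IsVirtuallyNilpotent K) :
    ∃ N : Subgroup G, N ≤ K ∧ N.Normal ∧ Group.IsNilpotent N ∧ (N.subgroupOf K).FiniteIndex := by
  obtain ⟨N₀, hN₀, hfin⟩ := hK
  set N₁ := N₀.normalCore
  have hN₁ : Group.IsNilpotent N₁ :=
    have : Group.IsNilpotent (N₁.subgroupOf N₀) := inferInstance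
    Group.nilpotent_of_mulEquiv (Subgroup.subgroupOfEquivOfLe (Subgroup.normalCore_le N₀))
  set d := N₁.index
  have hd : 0 < d := Nat.pos_of_ne_zero Subgroup.FiniteIndex.index_ne_zero
  -- Generated by all d-th powers of K, this is invariant under conjugation in G, and it lies in N₁
  -- because d is the index of N₁.
  set N := Subgroup.closure {y : G | ∃ x ∈ K, x ^ d = y} with hN
  have hNN₁ : N ≤ N₁.map K.subtype := by
    rw [hN, Subgroup.closure_le]
    rintro _ ⟨x, hx, rfl⟩
    exact ⟨⟨x, hx⟩ ^ d, N₁.pow_index_mem _, rfl⟩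
  have hNn : N.Normal := by
    refine ⟨fun v hv g => ?_⟩
    have : N ≤ N.comap (MulAut.conj g).toMonoidHom := by
      conv_lhs => rw [hN]
      rw [Subgroup.closure_le]
      rintro _ ⟨x, hx, rfl⟩
      exact Subgroup.subset_closure ⟨g * x * g⁻¹, Subgroup.Normal.conj_mem inferInstance x hx g,
        conj_pow⟩
    exact this hv
  have hmapnil : Group.IsNilpotent (N₁.map K.subtype) :=
    Group.nilpotent_of_mulEquiv (N₁.equivMapOfInjective K.subtype K.subtype_injective)
  have hNnil : Group.IsNilpotent N :=
    have : Group.IsNilpotent (N.subgroupOf (N₁.map K.subtype)) := inferInstance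
    Group.nilpotent_of_mulEquiv (Subgroup.subgroupOfEquivOfLe hNN₁)
  refine ⟨N, hNN₁.trans (Subgroup.map_subtype_le _), hNn, hNnil, ?_⟩
  set M := N.subgroupOf K
  have hpow : ∀ x : K ⧸ M, x ^ d = 1 := fun x => by
    induction x using QuotientGroup.induction_on with
    | H x =>
      rw [← QuotientGroup.mk_pow, QuotientGroup.eq_one_iff]
      exact Subgroup.subset_closure ⟨x, x.2, rfl⟩
  obtain ⟨h, hh⟩ := Group.IsNilpotent.exists_centralCyclicSeries N₁
  -- K ⧸ M has exponent d, and the image of N₁ in it is finitely generated nilpotent, hence finite;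
  -- it also has finite index.
  have hfin₁ : Finite (N₁.map (QuotientGroup.mk' M)) :=
    (hh.card_le_of_exponent d hd (N₁.map (QuotientGroup.mk' M))
      ((QuotientGroup.mk' M).subgroupMap N₁) ((QuotientGroup.mk' M).subgroupMap_surjective N₁)
      (fun x => Subtype.ext (by simpa using hpow x))).1
  have hidx : (N₁.map (QuotientGroup.mk' M)).FiniteIndex := by
    refine ⟨fun h0 => ?_⟩
    have := Subgroup.index_map_dvd (H := N₁) (QuotientGroup.mk'_surjective M)
    rw [h0, zero_dvd_iff] at this
    exact hd.ne' this
  have : Finite (K ⧸ M) := (Subgroup.finite_iff_finite_and_finiteIndex _).2 ⟨hfin₁, hidx⟩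
  exact Subgroup.finiteIndex_of_finite_quotient

/-! ### Automorphisms satisfying recurrences with small coefficients -/

open Polynomial in
/-- Every vector is recovered from its images under powers of each power of `T` by a recurrence
with coefficients in `{-1, 0, 1}`. -/
def SmallRecurrence {V : Type*} [AddCommGroup V] (T : Module.End ℤ V) : Prop :=
  ∀ j : ℕ, 0 < j → ∀ v : V, ∃ P : ℤ[X], (∀ i, |P.coeff i| ≤ 1) ∧
    v = (T ^ j) (aeval (T ^ j) P v)

open Polynomial in
-- The geometric series bounds ‖μ * P(μ)‖ by a partial sum of 1/2 + 1/4 + ⋯, which is less than 1.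
theorem mul_eval_ne_one_of_norm_le_half (P : ℤ[X]) (hP : ∀ i, |P.coeff i| ≤ 1) (μ : ℂ)
    (hμ : ‖μ‖ ≤ 1 / 2) : 1 - μ * aeval μ P ≠ 0 := by
  intro h
  have h1 : μ * aeval μ P = 1 := (sub_eq_zero.1 h).symm
  have hgeom : ∀ n : ℕ, ∑ i ∈ Finset.range n, (1 / 2 : ℝ) ^ (i + 1) = 1 - (1 / 2) ^ n := by
    intro n
    induction n with
    | zero => simp
    | succ n ih => rw [Finset.sum_range_succ, ih]; ring
  have h2 : ‖μ * aeval μ P‖ ≤ ∑ i ∈ Finset.range (P.natDegree + 1), (1 / 2 : ℝ) ^ (i + 1) := by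
    rw [aeval_eq_sum_range, Finset.mul_sum]
    refine (norm_sum_le _ _).trans (Finset.sum_le_sum fun i _ => ?_)
    rw [zsmul_eq_mul, norm_mul, norm_mul, norm_pow, Complex.norm_intCast]
    have h3 : |((P.coeff i : ℤ) : ℝ)| ≤ 1 := by exact_mod_cast hP i
    calc ‖μ‖ * (|((P.coeff i : ℤ) : ℝ)| * ‖μ‖ ^ i) ≤ (1 / 2) * (1 * (1 / 2) ^ i) := by gcongr
      _ = _ := by ring
  rw [h1, hgeom, norm_one] at h2
  have : (0 : ℝ) < (1 / 2) ^ (P.natDegree + 1) := by positivity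
  linarith

open Polynomial TensorProduct in
-- If ‖μ‖ < 1, some power μ ^ j has norm at most 1/2; this is why recurrences are required for all
-- powers of T. The product of the 1 - X * P v over finitely many generators v annihilates T ^ j, so
-- μ ^ j is a root of one factor, which is impossible.
theorem SmallRecurrence.one_le_norm {V : Type*} [AddCommGroup V] [Module.Finite ℤ V]
    {T : Module.End ℤ V} (hT : SmallRecurrence T) (μ : ℂ) (w : ℂ ⊗[ℤ] V)
    (hw : Module.End.HasEigenvector (T.baseChange ℂ : Module.End ℂ (ℂ ⊗[ℤ] V)) μ w) :
    1 ≤ ‖μ‖ := by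
  by_contra! hlt
  obtain ⟨j, hj, hjμ⟩ : ∃ j : ℕ, 0 < j ∧ ‖μ ^ j‖ ≤ 1 / 2 := by
    obtain ⟨j, hj⟩ := exists_pow_lt_of_lt_one (show (0 : ℝ) < 1 / 2 by norm_num) hlt
    refine ⟨j + 1, by omega, ?_⟩
    rw [norm_pow, pow_succ]
    have := norm_nonneg μ
    have := pow_nonneg this j
    nlinarith
  obtain ⟨S, hS⟩ := (Module.Finite.fg_top : (⊤ : Submodule ℤ V).FG)
  choose P hP hPv using hT j hj
  set R : ℤ[X] := ∏ v ∈ S, (1 - X * P v) with hR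
  have hkill : aeval (T ^ j) R = 0 := by
    have : ∀ v ∈ (⊤ : Submodule ℤ V), aeval (T ^ j) R v = 0 := by
      intro v hv
      rw [← hS] at hv
      induction hv using Submodule.span_induction with
      | mem v hv =>
        obtain ⟨R', hR'⟩ := Finset.dvd_prod_of_mem (fun v => 1 - X * P v) hv
        rw [hR, hR', mul_comm, map_mul, Module.End.mul_apply]
        have : aeval (T ^ j) (1 - X * P v) v = 0 := by
          rw [map_sub, map_one, map_mul, aeval_X, LinearMap.sub_apply, Module.End.one_apply,
            Module.End.mul_apply, ← hPv, sub_self]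
        rw [this, map_zero]
      | zero => exact map_zero _
      | add x y _ _ hx hy => rw [map_add, hx, hy, add_zero]
      | smul a x _ hx => rw [map_smul, hx, smul_zero]
    exact LinearMap.ext fun v => this v Submodule.mem_top
  have hkill' : aeval T (expand ℤ j R) = 0 := by rw [expand_aeval, hkill]
  have h1 : aeval (T.baseChange ℂ : Module.End ℂ (ℂ ⊗[ℤ] V)) (expand ℤ j R) = 0 := by
    have := aeval_algHom_apply (Module.End.baseChangeHom ℤ ℂ V) T (expand ℤ j R)
    rw [hkill', map_zero] at this
    exact this
  have h2 := Module.End.aeval_apply_of_hasEigenvector (p := (expand ℤ j R).map (algebraMap ℤ ℂ)) hw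
  rw [aeval_map_algebraMap, h1, LinearMap.zero_apply] at h2
  have h3 := (smul_eq_zero.1 h2.symm).resolve_right hw.2
  rw [eval_map_algebraMap, expand_aeval, hR, map_prod, Finset.prod_eq_zero_iff] at h3
  obtain ⟨v, _, hv⟩ := h3
  refine mul_eval_ne_one_of_norm_le_half (P v) (hP v) (μ ^ j) hjμ ?_
  simpa using hv

open Polynomial TensorProduct in
-- The bound for T and its inverse puts every eigenvalue on the unit circle, so the monic integral
-- characteristic polynomial has Mahler measure 1. By Kronecker its roots are roots of unity; for a
-- common exponent k it divides a power of X ^ k - 1, and Cayley-Hamilton applies.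
theorem exists_pow_sub_one_pow_eq_zero_of_free {V : Type*} [AddCommGroup V] [Module.Finite ℤ V]
    [Module.Free ℤ V] (T T' : Module.End ℤ V) (hTT' : T' * T = 1) (hT : SmallRecurrence T)
    (hT' : SmallRecurrence T') : ∃ k r : ℕ, 0 < k ∧ (T ^ k - 1) ^ r = 0 := by
  classical
  set χ := T.charpoly with hχ
  have hmonic : χ.Monic := T.charpoly_monic
  set χc := χ.map (Int.castRingHom ℂ) with hχc
  have hχc0 : χc ≠ 0 := (hmonic.map _).ne_zero
  have hnorm : ∀ μ ∈ χc.roots, ‖μ‖ = 1 := by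
    intro μ hμ
    have h1 : Module.End.HasEigenvalue (T.baseChange ℂ : Module.End ℂ (ℂ ⊗[ℤ] V)) μ := by
      rw [Module.End.hasEigenvalue_iff_isRoot_charpoly, LinearMap.charpoly_baseChange]
      exact isRoot_of_mem_roots hμ
    obtain ⟨w, hw⟩ := h1.exists_hasEigenvector
    have h2 := hT.one_le_norm μ w hw
    have hμ0 : μ ≠ 0 := by rintro rfl; simp at h2; linarith
    have h3 : Module.End.HasEigenvector (T'.baseChange ℂ : Module.End ℂ (ℂ ⊗[ℤ] V)) μ⁻¹ w := by
      refine ⟨Module.End.mem_eigenspace_iff.2 ?_, hw.2⟩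
      have h4 : (T'.baseChange ℂ) ((T.baseChange ℂ) w) = w := by
        rw [← LinearMap.comp_apply, ← LinearMap.baseChange_comp]
        have : T' ∘ₗ T = LinearMap.id := hTT'
        rw [this, LinearMap.baseChange_id, LinearMap.id_apply]
      have h5 : (T.baseChange ℂ) w = μ • w := Module.End.mem_eigenspace_iff.1 hw.1
      rw [h5, map_smul] at h4
      rw [eq_inv_smul_iff₀ hμ0]
      exact h4
    have h4 := hT'.one_le_norm μ⁻¹ w h3
    rw [norm_inv] at h4
    exact le_antisymm ((one_le_inv₀ (by linarith)).1 h4) h2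
  have hmahler : χc.mahlerMeasure = 1 := by
    rw [mahlerMeasure_eq_leadingCoeff_mul_prod_roots, (hmonic.map _).leadingCoeff, norm_one,
      one_mul]
    refine Multiset.prod_eq_one fun x hx => ?_
    obtain ⟨μ, hμ, rfl⟩ := Multiset.mem_map.1 hx
    rw [hnorm μ hμ, max_self]
  have hunity : ∀ μ ∈ χc.roots, ∃ n, 0 < n ∧ μ ^ n = 1 := fun μ hμ =>
    pow_eq_one_of_mahlerMeasure_eq_one (p := χ) hmahler
      (by rintro rfl; simpa using hnorm 0 hμ) hμ
  choose! n hn hn1 using hunity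
  set k := ∏ μ ∈ χc.roots.toFinset, n μ with hk
  have hk0 : 0 < k := Finset.prod_pos fun μ hμ => hn μ (Multiset.mem_toFinset.1 hμ)
  have hk1 : ∀ μ ∈ χc.roots, μ ^ k = 1 := by
    intro μ hμ
    obtain ⟨q, hq⟩ := Finset.dvd_prod_of_mem n (Multiset.mem_toFinset.2 hμ)
    rw [hk, hq, pow_mul, hn1 μ hμ, one_pow]
  have hdvdc : χc ∣ (X ^ k - 1) ^ Multiset.card χc.roots := by
    have hsplit := (IsAlgClosed.splits χc).eq_prod_roots_of_monic (hmonic.map _)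
    have h1 : (χc.roots.map (X - C ·)).prod ∣ (χc.roots.map fun _ => (X ^ k - 1 : ℂ[X])).prod := by
      apply Multiset.prod_dvd_prod_of_dvd
      intro μ hμ
      rw [dvd_iff_isRoot]
      simp [hk1 μ hμ]
    rw [← hsplit, Multiset.map_const', Multiset.prod_replicate] at h1
    exact h1
  have hdvd : χ ∣ (X ^ k - 1) ^ Multiset.card χc.roots := by
    rw [← map_dvd_map (Int.castRingHom ℂ) Int.cast_injective hmonic]
    simpa using hdvdc
  refine ⟨k, Multiset.card χc.roots, hk0, ?_⟩
  obtain ⟨q, hq⟩ := hdvd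
  have h1 : aeval T ((X ^ k - 1 : ℤ[X]) ^ Multiset.card χc.roots) = 0 := by
    rw [hq, map_mul, hχ, LinearMap.aeval_self_charpoly, zero_mul]
  simpa using h1

open Polynomial in
theorem map_aeval_of_comm {V W : Type*} [AddCommGroup V] [AddCommGroup W] (f : V →ₗ[ℤ] W)
    (T : Module.End ℤ V) (S : Module.End ℤ W) (h : ∀ v, f (T v) = S (f v)) (P : ℤ[X]) (v : V) :
    f (aeval T P v) = aeval S P (f v) := by
  have hpow : ∀ n : ℕ, ∀ v, f ((T ^ n) v) = (S ^ n) (f v) := by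
    intro n
    induction n with
    | zero => intro v; rfl
    | succ n ih => intro v; rw [pow_succ, pow_succ, Module.End.mul_apply, Module.End.mul_apply, ih, h]
  rw [aeval_eq_sum_range, aeval_eq_sum_range]
  simp [LinearMap.sum_apply, hpow]

open Polynomial in
/-- An automorphism of a finitely generated abelian group satisfying small recurrences in both
directions is virtually unipotent. -/
theorem SmallRecurrence.exists_pow_sub_one_pow_eq_zero {V : Type*} [AddCommGroup V]
    [Module.Finite ℤ V] (T T' : Module.End ℤ V) (hTT' : T' * T = 1) (hT : SmallRecurrence T)
    (hT' : SmallRecurrence T') :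
    ∃ k r : ℕ, 0 < k ∧ ∀ j : ℕ, (T ^ (k * j) - 1) ^ r = 0 := by
  set τ := Submodule.torsion ℤ V with hτ
  have hinv : ∀ S : Module.End ℤ V, τ ≤ τ.comap S := by
    rintro S v ⟨a, ha⟩
    exact ⟨a, by
      have := congrArg S ha
      rwa [Submonoid.smul_def, map_smul, map_zero, ← Submonoid.smul_def] at this⟩
  let bar : Module.End ℤ V → Module.End ℤ (V ⧸ τ) := fun S => τ.mapQ τ S (hinv S)
  have hbar : ∀ S v, bar S (τ.mkQ v) = τ.mkQ (S v) := fun S v => rfl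
  have hbarpow : ∀ (S : Module.End ℤ V) (j : ℕ) v, (bar S ^ j) (τ.mkQ v) = τ.mkQ ((S ^ j) v) := by
    intro S j v
    have := map_aeval_of_comm τ.mkQ S (bar S) (fun v => (hbar S v).symm) (X ^ j) v
    simpa using this.symm
  have hrec : ∀ S : Module.End ℤ V, SmallRecurrence S → SmallRecurrence (bar S) := by
    intro S hS j hj v
    obtain ⟨v, rfl⟩ := τ.mkQ_surjective v
    obtain ⟨P, hP, hv⟩ := hS j hj v
    refine ⟨P, hP, ?_⟩
    rw [← map_aeval_of_comm τ.mkQ (S ^ j) (bar S ^ j) (fun v => (hbarpow S j v).symm), hbarpow,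
      ← hv]
  obtain ⟨k₁, r, hk₁, h₁⟩ := exists_pow_sub_one_pow_eq_zero_of_free (bar T) (bar T')
    (by
      refine LinearMap.ext fun v => ?_
      obtain ⟨v, rfl⟩ := τ.mkQ_surjective v
      rw [Module.End.mul_apply, hbar, hbar, ← Module.End.mul_apply, hTT']
      rfl)
    (hrec T hT) (hrec T' hT')
  have hfin : Finite τ := Module.finite_of_fg_torsion τ (Submodule.torsion_isTorsion (R := ℤ))
  have hTinj : Function.Injective T := fun x y h => by
    have : (T' * T) x = (T' * T) y := congrArg T' h
    rwa [hTT'] at this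
  obtain ⟨k₂, hk₂, h₂⟩ : ∃ k₂ : ℕ, 0 < k₂ ∧ ∀ v ∈ τ, (T ^ k₂) v = v := by
    have hmem : ∀ (n : ℕ) (v : τ), (T ^ n) v ∈ τ := fun n v => hinv (T ^ n) v.2
    let φ : ℕ → τ → τ := fun n v => ⟨(T ^ n) v, hmem n v⟩
    obtain ⟨m, n, hmn, he⟩ := Finite.exists_ne_map_eq_of_infinite φ
    wlog hlt : m < n generalizing m n
    · exact this n m hmn.symm he.symm (lt_of_le_of_ne (not_lt.1 hlt) hmn.symm)
    refine ⟨n - m, by omega, fun v hv => ?_⟩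
    have h3 := congrArg Subtype.val (congrFun he ⟨v, hv⟩)
    have h4 : (T ^ m) v = (T ^ m) ((T ^ (n - m)) v) := by
      rw [← Module.End.mul_apply, ← pow_add, show m + (n - m) = n by omega]
      exact h3
    have hinj : Function.Injective (T ^ m) := by
      rw [Module.End.coe_pow]; exact hTinj.iterate m
    exact (hinj h4).symm
  -- The r-th power maps V into its finite torsion subgroup, and one further factor kills the
  -- torsion, which T ^ k₂ fixes pointwise.
  refine ⟨k₁ * k₂, r + 1, Nat.mul_pos hk₁ hk₂, fun j => ?_⟩
  have hd₁ : (X ^ k₁ - 1 : ℤ[X]) ^ r ∣ (X ^ (k₁ * k₂ * j) - 1) ^ r := by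
    apply pow_dvd_pow_of_dvd
    rw [mul_assoc, pow_mul]
    simpa using sub_dvd_pow_sub_pow (X ^ k₁ : ℤ[X]) 1 (k₂ * j)
  have hd₂ : (X ^ k₂ - 1 : ℤ[X]) ∣ X ^ (k₁ * k₂ * j) - 1 := by
    rw [show k₁ * k₂ * j = k₂ * (k₁ * j) by ring, pow_mul]
    simpa using sub_dvd_pow_sub_pow (X ^ k₂ : ℤ[X]) 1 (k₁ * j)
  obtain ⟨q₁, hq₁⟩ := hd₁
  obtain ⟨q₂, hq₂⟩ := hd₂
  have hto : ∀ v, aeval T ((X ^ (k₁ * k₂ * j) - 1 : ℤ[X]) ^ r) v ∈ τ := by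
    intro v
    rw [← Submodule.Quotient.mk_eq_zero]
    show τ.mkQ _ = 0
    rw [map_aeval_of_comm τ.mkQ T (bar T) (fun v => (hbar T v).symm), hq₁, map_mul]
    have : aeval (bar T) ((X ^ k₁ - 1 : ℤ[X]) ^ r) = 0 := by simpa using h₁
    rw [this, zero_mul, LinearMap.zero_apply]
  have hkill : ∀ v ∈ τ, aeval T (X ^ (k₁ * k₂ * j) - 1 : ℤ[X]) v = 0 := by
    intro v hv
    rw [hq₂, mul_comm, map_mul, Module.End.mul_apply]
    have : aeval T (X ^ k₂ - 1 : ℤ[X]) v = 0 := by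
      simp [h₂ v hv]
    rw [this, map_zero]
  refine LinearMap.ext fun v => ?_
  have := hkill _ (hto v)
  rw [← Module.End.mul_apply, ← map_mul, ← pow_succ'] at this
  simpa using this

theorem Subgroup.FG.map_hom {G H : Type*} [Group G] [Group H] {K : Subgroup G} (hK : K.FG)
    (f : G →* H) : (K.map f).FG := by
  classical
  obtain ⟨S, rfl⟩ := hK
  exact ⟨S.image f, by rw [Finset.coe_image, MonoidHom.map_closure]⟩

theorem Group.IsVirtuallyNilpotent.of_mulEquiv {G H : Type*} [Group G] [Group H]
    (hG : Group.IsVirtuallyNilpotent G) (e : G ≃* H) : Group.IsVirtuallyNilpotent H := by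
  obtain ⟨N, hN, hfin⟩ := hG
  refine ⟨N.map e.toMonoidHom, ?_, ⟨?_⟩⟩
  · exact Group.nilpotent_of_mulEquiv (e.subgroupMap N)
  · exact (Subgroup.index_map_equiv N e).trans_ne hfin.index_ne_zero

/-! ### Abelian normal subgroups -/

open Polynomial in
/-- The polynomial whose coefficients are the bits of `l`. -/
noncomputable def bitPoly : List Bool → ℤ[X]
  | [] => 0
  | true :: l => 1 + X * bitPoly l
  | false :: l => X * bitPoly l

theorem bitPoly_coeff (l : List Bool) : ∀ i, (bitPoly l).coeff i = 0 ∨ (bitPoly l).coeff i = 1 := by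
  induction l with
  | nil => intro i; simp [bitPoly]
  | cons e l ih =>
    intro i
    cases e <;> cases i <;> simp [bitPoly, Polynomial.coeff_one, ih]

open Polynomial in
-- In additive notation the relation for v and t ^ j reads v + S P₁(S) v = S P₂(S) v, where S = T ^
-- j and the coefficients of P₁, P₂ are the bits of the two words.
theorem PositiveRelations.smallRecurrence {G V : Type*} [Group G] [AddCommGroup V]
    (h : PositiveRelations G) (e : V →+ Additive G) (he : Function.Injective e) (t : G)
    (T : Module.End ℤ V)
    (hT : ∀ v, (e (T v)).toMul = t * (e v).toMul * t⁻¹) : SmallRecurrence T := by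
  intro j hj v
  clear hj
  set S := T ^ j with hSdef
  set b := t ^ j with hb
  have hS : ∀ v, (e (S v)).toMul = b * (e v).toMul * b⁻¹ := by
    rw [hSdef, hb]
    clear hSdef hb
    clear_value b S
    induction j with
    | zero => intro v; simp
    | succ j ih =>
      intro v
      rw [pow_succ, Module.End.mul_apply, ih, hT, pow_succ]
      group
  obtain ⟨l₁, l₂, hl, hrel⟩ := h (e v).toMul b
  have key : ∀ l, posWord (e v).toMul b l = (e (aeval S (bitPoly l) v)).toMul * b ^ l.length := by
    intro l
    induction l with
    | nil => simp [posWord, bitPoly]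
    | cons x l ih =>
      cases x
      · simp only [posWord, bitPoly, map_mul, aeval_X, Module.End.mul_apply, hS, ih,
          List.length_cons, pow_succ']
        group
      · simp only [posWord, bitPoly, map_mul, aeval_X, Module.End.mul_apply, hS, ih,
          List.length_cons, pow_succ', map_add, map_one, LinearMap.add_apply, Module.End.one_apply,
          toMul_add]
        group
  refine ⟨bitPoly l₂ - bitPoly l₁, fun i => ?_, he ?_⟩
  · rw [coeff_sub]
    rcases bitPoly_coeff l₁ i with h1 | h1 <;> rcases bitPoly_coeff l₂ i with h2 | h2 <;>
      simp [h1, h2]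
  · apply Additive.toMul.injective
    rw [hS, map_sub, LinearMap.sub_apply, map_sub, toMul_sub]
    rw [key, key, hl] at hrel
    have : (e v).toMul * b * (e (aeval S (bitPoly l₁) v)).toMul =
        b * (e (aeval S (bitPoly l₂) v)).toMul :=
      mul_right_cancel (b := b ^ l₂.length) (by simpa [mul_assoc] using hrel)
    rw [div_eq_mul_inv]
    calc (e v).toMul = ((e v).toMul * b * (e (aeval S (bitPoly l₁) v)).toMul) *
          (e (aeval S (bitPoly l₁) v)).toMul⁻¹ * b⁻¹ := by group
      _ = _ := by rw [this]; group

/-- On the abelian group B, conjugation by t is a linear map T, and taking the commutator with t ^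
(k * j) is T ^ (k * j) - 1. -/
theorem PositiveRelations.exists_iterate_commutator_eq_one {G : Type*} [Group G]
    (h : PositiveRelations G) (B : Subgroup G) [B.Normal] (hfg : B.FG)
    (hB : ∀ x ∈ B, ∀ y ∈ B, x * y = y * x) (t : G) :
    ∃ k r : ℕ, 0 < k ∧ ∀ j : ℕ, ∀ v ∈ B, (fun v => ⁅t ^ (k * j), v⁆)^[r] v = 1 := by
  let _ : CommGroup B :=
    { (inferInstance : Group B) with mul_comm := fun x y => Subtype.ext (hB x x.2 y y.2) }
  have : Group.FG B := (Group.fg_iff_subgroup_fg B).2 hfg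
  have : Module.Finite ℤ (Additive B) := Module.Finite.iff_addGroup_fg.2 inferInstance
  let T : G → Module.End ℤ (Additive B) := fun s =>
    (MonoidHom.toAdditive (MulAut.conjNormal s : B ≃* B).toMonoidHom).toIntLinearMap
  let e : Additive B →+ Additive G := MonoidHom.toAdditive B.subtype
  have he : Function.Injective e := fun x y hxy => Subtype.ext hxy
  have hT : ∀ s v, (e (T s v)).toMul = s * (e v).toMul * s⁻¹ := fun s v => rfl
  have hinv : T t⁻¹ * T t = 1 := by
    refine LinearMap.ext fun v => he (Additive.toMul.injective ?_)
    rw [Module.End.mul_apply, hT, hT, Module.End.one_apply]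
    group
  obtain ⟨k, r, hk, hr⟩ := SmallRecurrence.exists_pow_sub_one_pow_eq_zero (T t) (T t⁻¹) hinv
    (h.smallRecurrence e he t _ (hT t)) (h.smallRecurrence e he t⁻¹ _ (hT t⁻¹))
  refine ⟨k, r, hk, fun j v hv => ?_⟩
  have hpow : ∀ m v, (e ((T t ^ m) v)).toMul = t ^ m * (e v).toMul * (t ^ m)⁻¹ := by
    intro m
    induction m with
    | zero => intro v; simp
    | succ m ih => intro v; rw [pow_succ, Module.End.mul_apply, ih, hT, pow_succ]; group
  have hit : ∀ r v, (e (((T t ^ (k * j) - 1) ^ r) v)).toMul =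
      (fun v => ⁅t ^ (k * j), v⁆)^[r] (e v).toMul := by
    intro r
    induction r with
    | zero => intro v; rfl
    | succ r ih =>
      intro v
      rw [pow_succ, Module.End.mul_apply, ih, Function.iterate_succ_apply]
      congr 1
      rw [LinearMap.sub_apply, map_sub, toMul_sub, hpow, Module.End.one_apply, div_eq_mul_inv,
        commutatorElement_def]
  have := hit r (Additive.ofMul (⟨v, hv⟩ : B))
  rw [hr j, LinearMap.zero_apply, map_zero] at this
  exact this.symm

/-! ### Nilpotency of cyclic extensions -/

theorem Subgroup.mem_upperCentralSeries_succ_of_sup_zpowers {G : Type*} [Group G]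
    {N : Subgroup G} {s : G} (hN : N ⊔ Subgroup.zpowers s = ⊤) {m : ℕ} {v : G}
    (h₁ : ∀ n ∈ N, ⁅n, v⁆ ∈ Subgroup.upperCentralSeries G m)
    (h₂ : ⁅s, v⁆ ∈ Subgroup.upperCentralSeries G m) :
    v ∈ Subgroup.upperCentralSeries G (m + 1) := by
  set Z := Subgroup.upperCentralSeries G m
  have hmem : ∀ g : G, g ∈ (Subgroup.centralizer {(QuotientGroup.mk' Z v)}).comap
      (QuotientGroup.mk' Z) ↔ ⁅g, v⁆ ∈ Z := by
    intro g
    rw [Subgroup.mem_comap, Subgroup.mem_centralizer_singleton_iff,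
      ← commutatorElement_eq_one_iff_mul_comm, ← map_commutatorElement]
    exact QuotientGroup.eq_one_iff _
  have htop : (⊤ : Subgroup G) ≤ (Subgroup.centralizer {(QuotientGroup.mk' Z v)}).comap
      (QuotientGroup.mk' Z) := by
    rw [← hN, sup_le_iff, Subgroup.zpowers_le]
    exact ⟨fun n hn => (hmem n).2 (h₁ n hn), (hmem s).2 h₂⟩
  rw [Subgroup.mem_upperCentralSeries_succ_iff]
  intro y
  rw [← inv_mem_iff, commutatorElement_inv]
  exact (hmem y).1 (htop trivial)

/-- Between Z i and Z (i + 1), commutation with N drops to Z i at once and commutation with s after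
finitely many iterations. So each Z i, and finally N, lies in the upper central series; s lies in
the next term because its commutators with N lie in N. -/
theorem Group.isNilpotent_of_iterate_commutator_mem {G : Type*} [Group G] {N : Subgroup G} {s : G}
    (hN : N ⊔ Subgroup.zpowers s = ⊤) (Z : ℕ → Subgroup G) [∀ i, (Z i).Normal] (c : ℕ)
    (h₀ : Z 0 = ⊥) (hc : N ≤ Z c)
    (hcomm : ∀ i, ∀ n ∈ N, ∀ v ∈ Z (i + 1), ⁅n, v⁆ ∈ Z i)
    (hs : ∀ i < c, ∃ r : ℕ, ∀ v ∈ Z (i + 1), (fun v => ⁅s, v⁆)^[r] v ∈ Z i) :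
    Group.IsNilpotent G := by
  have key : ∀ i ≤ c, ∃ n, Z i ≤ Subgroup.upperCentralSeries G n := by
    intro i
    induction i with
    | zero => exact fun _ => ⟨0, by rw [h₀]; exact bot_le⟩
    | succ i ih =>
      intro hi
      obtain ⟨n, hn⟩ := ih (by omega)
      obtain ⟨r, hr⟩ := hs i (by omega)
      have inner : ∀ j, ∀ v ∈ Z (i + 1), (fun v => ⁅s, v⁆)^[j] v ∈ Z i →
          v ∈ Subgroup.upperCentralSeries G (n + j) := by
        intro j
        induction j with
        | zero => exact fun v _ hv => hn hv
        | succ j ihj =>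
          intro v hv hj
          refine Subgroup.mem_upperCentralSeries_succ_of_sup_zpowers hN (fun x hx => ?_) ?_
          · exact Subgroup.upperCentralSeries_mono G (Nat.le_add_right n j) (hn (hcomm i x hx v hv))
          · refine ihj _ ?_ hj
            exact mul_mem (Subgroup.Normal.conj_mem inferInstance v hv s) (inv_mem hv)
      exact ⟨n + r, fun v hv => inner r v hv (hr v hv)⟩
  obtain ⟨n, hn⟩ := key c le_rfl
  have hNn : N ≤ Subgroup.upperCentralSeries G n := hc.trans hn
  refine ⟨n + 1, top_le_iff.1 ?_⟩
  rw [← hN, sup_le_iff, Subgroup.zpowers_le]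
  refine ⟨hNn.trans (Subgroup.upperCentralSeries_mono G (Nat.le_succ n)),
    Subgroup.mem_upperCentralSeries_succ_of_sup_zpowers hN (fun x hx => ?_) ?_⟩
  · rw [commutatorElement_def, mul_assoc, mul_assoc, ← mul_assoc s]
    exact mul_mem (hNn hx) (Subgroup.Normal.conj_mem inferInstance _ (inv_mem (hNn hx)) s)
  · rw [commutatorElement_self]; exact one_mem _

/-! ### Cyclic extensions of virtually nilpotent groups -/

theorem Subgroup.finiteIndex_sup_zpowers_pow {G : Type*} [Group G] {K N : Subgroup G} [K.Normal]
    [N.Normal] (hNK : (N.subgroupOf K).FiniteIndex) {t : G}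
    (ht : K ⊔ Subgroup.zpowers t = ⊤) {k : ℕ} (hk : 0 < k) :
    (N ⊔ Subgroup.zpowers (t ^ k)).FiniteIndex := by
  set H := N ⊔ Subgroup.zpowers (t ^ k)
  have : Finite (K ⧸ N.subgroupOf K) := Subgroup.finite_quotient_of_finiteIndex
  let f : (K ⧸ N.subgroupOf K) × Fin k → G ⧸ H := fun p => ((p.1.out : G) * t ^ (p.2 : ℕ) : G)
  have hf : Function.Surjective f := by
    intro q
    obtain ⟨g, rfl⟩ := QuotientGroup.mk_surjective q
    obtain ⟨n, x, hx, hgx⟩ := Subgroup.exists_zpow_mul_of_mem_sup (H := K) (t := t) (x := g⁻¹)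
      (by rw [Subgroup.normalizer_eq_top]; trivial) (by rw [ht]; trivial)
    have hg : g = x⁻¹ * t ^ (-n) := by rw [← inv_inv g, hgx]; simp
    set m := -n
    have hk' : (0 : ℤ) < k := by exact_mod_cast hk
    have hmod := Int.emod_nonneg m hk'.ne'
    have hlt : (m % k).toNat < k := by have := Int.emod_lt_of_pos m hk'; omega
    let y : K := ⟨x⁻¹, inv_mem hx⟩
    obtain ⟨ν, hν⟩ := QuotientGroup.mk_out_eq_mul (N.subgroupOf K) y
    refine ⟨((y : K ⧸ N.subgroupOf K), ⟨(m % k).toNat, hlt⟩), ?_⟩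
    have hνN : ((ν : K) : G) ∈ N := Subgroup.mem_subgroupOf.1 ν.2
    have hm : t ^ m = t ^ (m % k).toNat * (t ^ k) ^ (m / k) := by
      rw [← zpow_natCast t (m % k).toNat, ← zpow_natCast t k, ← zpow_mul, ← zpow_add,
        Int.toNat_of_nonneg hmod, Int.emod_add_mul_ediv]
    simp only [f]
    rw [QuotientGroup.eq, hν, hg, hm]
    have : (((y * (ν : K) : K) : G) * t ^ (m % ↑k).toNat)⁻¹ *
        (x⁻¹ * (t ^ (m % ↑k).toNat * (t ^ k) ^ (m / ↑k))) =
        ((t ^ (m % ↑k).toNat)⁻¹ * ((ν : K) : G)⁻¹ * ((t ^ (m % ↑k).toNat)⁻¹)⁻¹) *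
          (t ^ k) ^ (m / ↑k) := by
      simp only [Subgroup.coe_mul, y]; group
    rw [this]
    refine mul_mem (Subgroup.mem_sup_left ?_) (Subgroup.mem_sup_right ?_)
    · exact Subgroup.Normal.conj_mem inferInstance _ (inv_mem hνN) _
    · exact zpow_mem (Subgroup.mem_zpowers _) _
  have := Finite.of_surjective f hf
  exact Subgroup.finiteIndex_of_finite_quotient

theorem PositiveRelations.isVirtuallyNilpotent_of_cyclic {G : Type*} [Group G]
    (h : PositiveRelations G) (K : Subgroup G) [K.Normal] [Group.FG K]
    (hK : Group.IsVirtuallyNilpotent K) {t : G} (ht : K ⊔ Subgroup.zpowers t = ⊤) :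
    Group.IsVirtuallyNilpotent G := by
  obtain ⟨N, hNK, hNn, hNil, hfin⟩ := exists_normal_nilpotent_of_isVirtuallyNilpotent K hK
  have hNfg : N.FG := by
    have h1 : Group.FG (N.subgroupOf K) := inferInstance
    have h2 := Subgroup.FG.map_hom ((Group.fg_iff_subgroup_fg _).1 h1) K.subtype
    rwa [Subgroup.map_subgroupOf_eq_of_le hNK] at h2
  have : Group.FG N := (Group.fg_iff_subgroup_fg N).2 hNfg
  obtain ⟨_, hseries⟩ := Group.IsNilpotent.exists_centralCyclicSeries N
  let Z : ℕ → Subgroup G := fun i => (Subgroup.upperCentralSeries N i).map N.subtype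
  have hZn : ∀ i, (Z i).Normal := fun i => inferInstance
  have hZN : ∀ i, Z i ≤ N := fun i => Subgroup.map_subtype_le _
  have hZcomm : ∀ i, ∀ n ∈ N, ∀ v ∈ Z (i + 1), ⁅n, v⁆ ∈ Z i := by
    rintro i n hn _ ⟨v, hv, rfl⟩
    refine ⟨⁅(⟨n, hn⟩ : N), v⁆, ?_, by simp [commutatorElement_def]⟩
    have := Subgroup.mem_upperCentralSeries_succ_iff.1 hv ⟨n, hn⟩
    rw [SetLike.mem_coe, ← inv_mem_iff, commutatorElement_inv]
    exact this
  have hfactor : ∀ i, ∃ k r : ℕ, 0 < k ∧ ∀ j : ℕ, ∀ v ∈ Z (i + 1),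
      (fun v => ⁅t ^ (k * j), v⁆)^[r] v ∈ Z i := by
    intro i
    let q := QuotientGroup.mk' (Z i)
    have hq : Function.Surjective q := QuotientGroup.mk'_surjective _
    have hBn : ((Z (i + 1)).map q).Normal := Subgroup.Normal.map (hZn _) q hq
    have hBfg : ((Z (i + 1)).map q).FG :=
      Subgroup.FG.map_hom (Subgroup.FG.map_hom (hseries.subgroup_fg _) N.subtype) q
    obtain ⟨k, r, hk, hr⟩ := (h.of_surjective q hq).exists_iterate_commutator_eq_one
      ((Z (i + 1)).map q) hBfg (by
        rintro _ ⟨x, hx, rfl⟩ _ ⟨y, hy, rfl⟩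
        rw [← commutatorElement_eq_one_iff_mul_comm, ← map_commutatorElement]
        exact (QuotientGroup.eq_one_iff _).2 (hZcomm i x (hZN _ hx) y hy)) (q t)
    refine ⟨k, r, hk, fun j v hv => (QuotientGroup.eq_one_iff _).1 ?_⟩
    have hsemi : Function.Semiconj q (fun v => ⁅t ^ (k * j), v⁆)
        (fun v => ⁅q t ^ (k * j), v⁆) := fun v => by
      rw [map_commutatorElement, map_pow]
    exact ((hsemi.iterate_right r).eq v).trans (hr j (q v) ⟨v, hv, rfl⟩)
  choose k r hk hr using hfactor
  obtain ⟨c, hc⟩ := hNil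
  -- The unipotence bounds hold for all multiples of k i, so the single power t ^ m serves every
  -- upper central factor of N.
  let m := ∏ i ∈ Finset.range c, k i
  have hm : 0 < m := Finset.prod_pos fun i _ => hk i
  refine ⟨N ⊔ Subgroup.zpowers (t ^ m), ?_, Subgroup.finiteIndex_sup_zpowers_pow hfin ht hm⟩
  set H := N ⊔ Subgroup.zpowers (t ^ m)
  have hNH : N ≤ H := le_sup_left
  have hsH : t ^ m ∈ H := Subgroup.mem_sup_right (Subgroup.mem_zpowers _)
  refine Group.isNilpotent_of_iterate_commutator_mem (N := N.subgroupOf H)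
    (s := ⟨t ^ m, hsH⟩) ?_ (fun i => (Z i).subgroupOf H) c ?_ ?_ ?_ ?_
  · rw [eq_top_iff]
    have hinj : Function.Injective H.subtype := H.subtype_injective
    rw [← Subgroup.map_le_map_iff_of_injective hinj, Subgroup.map_sup,
      Subgroup.map_subgroupOf_eq_of_le hNH, MonoidHom.map_zpowers, ← MonoidHom.range_eq_map,
      Subgroup.range_subtype]
    exact le_rfl
  · simp [Z]
  · intro x hx
    exact ⟨⟨x, hx⟩, by rw [hc]; trivial, rfl⟩
  · intro i n hn v hv
    exact hZcomm i n hn v hv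
  · intro i hi
    obtain ⟨j, hj⟩ := Finset.dvd_prod_of_mem k (Finset.mem_range.2 hi)
    refine ⟨r i, fun v hv => Subgroup.mem_subgroupOf.2 ?_⟩
    have hsemi : Function.Semiconj H.subtype (fun v => ⁅(⟨t ^ m, hsH⟩ : H), v⁆)
        (fun v => ⁅t ^ (k i * j), v⁆) := fun v => by
      rw [map_commutatorElement, ← hj]; rfl
    have := (hsemi.iterate_right (r i)).eq v
    change H.subtype _ ∈ Z i
    rw [this]
    exact hr i j v hv

/-! ### Solvable groups with positive relations -/

/-- Any subgroup between K and H is normal in H, so adjoining the generators one at a time gives a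
chain of cyclic extensions. Finite generation descends along it from H to K, and virtual nilpotency
ascends. -/
theorem PositiveRelations.fg_and_isVirtuallyNilpotent_of_commutator_le {G : Type*} [Group G]
    (h : PositiveRelations G) {K : Subgroup G} (s : Finset G) :
    ∀ H : Subgroup G, H.FG → K ≤ H → ⁅H, H⁆ ≤ K → H = K ⊔ Subgroup.closure s →
      K.FG ∧ (Group.IsVirtuallyNilpotent K → Group.IsVirtuallyNilpotent H) := by
  classical
  induction s using Finset.induction_on with
  | empty =>
    intro H hfg _ _ hH
    rw [Finset.coe_empty, Subgroup.closure_empty, sup_bot_eq] at hH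
    subst hH
    exact ⟨hfg, id⟩
  | insert b s _ ih =>
    intro H hfg hKH hcomm hH
    set H₁ := K ⊔ Subgroup.closure (s : Set G) with hH₁
    have hHb : H = H₁ ⊔ Subgroup.zpowers b := by
      rw [hH, hH₁, Finset.coe_insert, Set.insert_eq, Subgroup.closure_union,
        Subgroup.zpowers_eq_closure, sup_assoc, sup_comm (Subgroup.closure {b})]
    have hH₁H : H₁ ≤ H := hHb ▸ le_sup_left
    have hbH : b ∈ H := hHb ▸ Subgroup.mem_sup_right (Subgroup.mem_zpowers b)
    have hKH₁ : K ≤ H₁ := le_sup_left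
    have hnormal : (H₁.subgroupOf H).Normal := by
      refine ⟨fun x hx g => Subgroup.mem_subgroupOf.2 ?_⟩
      have h1 : ⁅(g : G), (x : G)⁆ ∈ H₁ :=
        hKH₁ (hcomm (Subgroup.commutator_mem_commutator g.2 x.2))
      have h2 := mul_mem h1 (Subgroup.mem_subgroupOf.1 hx)
      simpa [commutatorElement_def] using h2
    have hb : b ∈ Subgroup.normalizer (H₁ : Set G) :=
      (Subgroup.normal_subgroupOf_iff_le_normalizer hH₁H).1 hnormal hbH
    have hH₁fg : H₁.FG := h.fg_of_cyclic hHb hb hfg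
    obtain ⟨hKfg, hKvn⟩ := ih H₁ hH₁fg hKH₁
      ((Subgroup.commutator_mono hH₁H hH₁H).trans hcomm) rfl
    refine ⟨hKfg, fun hK => ?_⟩
    let e : H₁.subgroupOf H ≃* H₁ := Subgroup.subgroupOfEquivOfLe hH₁H
    have : Group.FG H₁ := (Group.fg_iff_subgroup_fg _).2 hH₁fg
    have : Group.FG (H₁.subgroupOf H) := Group.fg_of_surjective (f := e.symm.toMonoidHom) e.symm.surjective
    refine (h.subgroup H).isVirtuallyNilpotent_of_cyclic (H₁.subgroupOf H)
      ((hKvn hK).of_mulEquiv e.symm) (t := ⟨b, hbH⟩) ?_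
    rw [eq_top_iff, ← Subgroup.map_le_map_iff_of_injective H.subtype_injective, Subgroup.map_sup,
      Subgroup.map_subgroupOf_eq_of_le hH₁H, MonoidHom.map_zpowers, ← MonoidHom.range_eq_map,
      Subgroup.range_subtype]
    exact hHb.le

theorem PositiveRelations.isVirtuallyNilpotent_of_derivedSeries_eq_bot (n : ℕ) :
    ∀ (G : Type u) [Group G] [Group.FG G], PositiveRelations G → derivedSeries G n = ⊥ →
      Group.IsVirtuallyNilpotent G := by
  induction n with
  | zero =>
    intro G _ _ _ hG
    have : Subsingleton G := by
      rw [derivedSeries_zero] at hG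
      exact Subgroup.subsingleton_iff.1 (subsingleton_of_bot_eq_top hG.symm)
    exact ⟨⊤, inferInstance, inferInstance⟩
  | succ n ih =>
    intro G _ _ h hG
    obtain ⟨s, hs⟩ : (⊤ : Subgroup G).FG := (Group.fg_def).1 inferInstance
    -- The finite generation of the commutator subgroup obtained here is what lets the induction
    -- hypothesis apply to it.
    obtain ⟨hfg, hvn⟩ := h.fg_and_isVirtuallyNilpotent_of_commutator_le (K := commutator G) s ⊤
      ⟨s, hs⟩ le_top le_rfl (by rw [hs, sup_top_eq])
    have : Group.FG (commutator G) := (Group.fg_iff_subgroup_fg _).2 hfg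
    refine (hvn (ih _ (h.subgroup _) ?_)).of_mulEquiv Subgroup.topEquiv
    have hle : ∀ m, (derivedSeries (commutator G) m).map (commutator G).subtype ≤
        derivedSeries G (m + 1) := by
      intro m
      induction m with
      | zero =>
        rw [zero_add, derivedSeries_one]
        exact Subgroup.map_subtype_le _
      | succ m ihm =>
        rw [derivedSeries_succ, Subgroup.map_commutator, derivedSeries_succ G (m + 1)]
        exact Subgroup.commutator_mono ihm ihm
    rw [← Subgroup.map_eq_bot_iff_of_injective _ (commutator G).subtype_injective]
    exact le_bot_iff.1 ((hle n).trans hG.le)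

theorem mainTheorem5 {G : Type*} [Group G] [Group.IsSolvable G] (X : Set G) (hX : X.Finite)
    (hgen : Subgroup.closure X = ⊤) :
    AtMostPolynomialInLog (normalRFGrowth X) ↔ Group.IsVirtuallyNilpotent G := by
  have : Group.FG G := Group.fg_iff.2 ⟨X, hgen, hX⟩
  refine ⟨fun h => ?_, fun h => h.polylogRF.atMostPolynomialInLog X hX hgen⟩
  obtain ⟨n, hn⟩ := Group.IsSolvable.solvable (G := G)
  exact (h.positiveRelations hX hgen).isVirtuallyNilpotent_of_derivedSeries_eq_bot n G hn
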